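/- Let $\lg=\log_2$. For an abelian group $G$, a vector $\boldsymbol\alpha=(\alpha_1,\ldots,\alpha_k)$ of elements of $G$ is a basis for $G$ if every $\beta\in G$ can be written uniquely as $\beta=\alpha_1^{x_1}\cdots\alpha_k^{x_k}$ with integers $0\le x_i<|\alpha_i|$; then $\mathrm{DL}(\boldsymbol\alpha,\beta)=(x_1,\ldots,x_k)$. A (deterministic) generic algorithm is an algorithm that accesses the group only through a black box, which assigns to the group elements arbitrary unique identifiers and, on request, returns the identity, the product of two elements or the inverse of an element already received; each such request is one group operation. There are a deterministic generic algorithm and an absolute constant $C$ such that the following holds for every prime $p$, every nontrivial finite abelian $p$-group $G$, of size $p^n$, exponent $p^m$ and rank $r$, every basis $\boldsymbol\alpha$ for $G$, and every $\beta\in G$. Given $p$, the integers $\log_p|\alpha_i|$, and (through the black box) $\boldsymbol\alpha$ and $\beta$, the algorithm computes $\mathrm{DL}(\boldsymbol\alpha,\beta)$ using at most $$C\left(\frac{\lg(m+1)}{\lg\lg(m+2)}\,\lg|G|+\frac{n}{r}\,p^{r/2}\right)$$ group operations. -/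

import Mathlib

/-- The vector `x` is a discrete logarithm of `β` with respect to `α = (α₁, …, α_k)`:
`β = α₁ ^ x₁ ⋯ α_k ^ x_k` with `0 ≤ x_i < |α_i|`. -/
def IsDiscreteLog {G : Type*} [CommGroup G] {k : ℕ} (α : Fin k → G) (β : G)
    (x : Fin k → ℕ) : Prop :=
  (∀ i, x i < orderOf (α i)) ∧ ∏ i, α i ^ x i = β

/-- The vector `α` is a basis for the abelian group `G`: every element has exactly one discrete
logarithm with respect to `α`. (Trivial entries `α_i = 1` are allowed.) -/
def IsGroupBasis {G : Type*} [CommGroup G] {k : ℕ} (α : Fin k → G) : Prop :=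
  ∀ β : G, ∃! x : Fin k → ℕ, IsDiscreteLog α β x

/-- What a generic algorithm can do next: ask the black box for the identity, for a product or for
an inverse, or halt with an output. The operands are named by their positions in the list of all
group elements received so far, so that only elements that have been received can be used. -/
inductive GenericAction (O : Type) : Type
  | one : GenericAction O
  | mul (i j : ℕ) : GenericAction O
  | inv (i : ℕ) : GenericAction O
  | output (x : O) : GenericAction O

/-- The data of an action, as a sum type (used only to code actions by natural numbers). -/
def GenericAction.equivSum (O : Type) : GenericAction O ≃ (Unit ⊕ (ℕ × ℕ)) ⊕ (ℕ ⊕ O) where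
  toFun a := match a with
    | .one => .inl (.inl ())
    | .mul i j => .inl (.inr (i, j))
    | .inv i => .inr (.inl i)
    | .output x => .inr (.inr x)
  invFun s := match s with
    | .inl (.inl _) => .one
    | .inl (.inr q) => .mul q.1 q.2
    | .inr (.inl i) => .inv i
    | .inr (.inr x) => .output x
  left_inv a := by cases a <;> rfl
  right_inv s := by rcases s with (_ | _) | (_ | _) <;> rfl

instance {O : Type} [Primcodable O] : Primcodable (GenericAction O) :=
  Primcodable.ofEquiv _ (GenericAction.equivSum O)

/-- A deterministic generic group algorithm with auxiliary inputs in `I` and outputs in `O`.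
It does not depend on a group: from the auxiliary input and the list of the identifiers (natural
numbers) of all group elements received so far, beginning with the given ones, it computes its next
action. One such function serves all inputs, all groups and all choices of identifiers. -/
structure GenericAlgorithm (I O : Type) [Primcodable I] [Primcodable O] where
  next : I × List ℕ → GenericAction O
  computable_next : Computable next

/-- `A.Computes a ν L t x`: with auxiliary input `a`, in the group `G` whose black box uses the
identifiers `ν`, and having received the group elements `L`, the algorithm `A` performs exactly `t`
further group operations (identity, products and inverses, each of cost one, including those that
involve the identity element) and then halts with output `x`. -/
inductive GenericAlgorithm.Computes {I O : Type} [Primcodable I] [Primcodable O]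
    (A : GenericAlgorithm I O) (a : I) {G : Type*} [Group G] (ν : G → ℕ) :
    List G → ℕ → O → Prop
  | output {L : List G} {x : O} (h : A.next (a, L.map ν) = .output x) :
      GenericAlgorithm.Computes A a ν L 0 x
  | one {L : List G} {t : ℕ} {x : O} (h : A.next (a, L.map ν) = .one)
      (hr : GenericAlgorithm.Computes A a ν (L ++ [1]) t x) :
      GenericAlgorithm.Computes A a ν L (t + 1) x
  | mul {L : List G} {t : ℕ} {x : O} {i j : ℕ} {g g' : G}
      (h : A.next (a, L.map ν) = .mul i j) (hi : L[i]? = some g) (hj : L[j]? = some g')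
      (hr : GenericAlgorithm.Computes A a ν (L ++ [g * g']) t x) :
      GenericAlgorithm.Computes A a ν L (t + 1) x
  | inv {L : List G} {t : ℕ} {x : O} {i : ℕ} {g : G}
      (h : A.next (a, L.map ν) = .inv i) (hi : L[i]? = some g)
      (hr : GenericAlgorithm.Computes A a ν (L ++ [g⁻¹]) t x) :
      GenericAlgorithm.Computes A a ν L (t + 1) x

/-- `Gen c K A`: starting from the elements of `K`, at most `c` multiplications produce all
elements of `A`. -/
inductive Gen {M : Type*} [Mul M] : ℕ → Set M → Set M → Prop
  | of_subset {c : ℕ} {K A : Set M} (h : A ⊆ K) : Gen c K A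
  | mul {c : ℕ} {K A : Set M} {a b : M} (ha : a ∈ K) (hb : b ∈ K)
      (h : Gen c (insert (a * b) K) A) : Gen (c + 1) K A

namespace Gen

variable {M N : Type*} [Mul M] [Mul N] {c d : ℕ} {K K' A A' : Set M}

theorem mono_cost (h : Gen c K A) (hcd : c ≤ d) : Gen d K A := by
  induction h generalizing d with
  | of_subset h => exact .of_subset h
  | mul ha hb _ ih =>
    obtain ⟨d, rfl⟩ : ∃ d', d = d' + 1 := ⟨d - 1, by omega⟩
    exact .mul ha hb (ih (by omega))

theorem mono_left (h : Gen c K A) (hK : K ⊆ K') : Gen c K' A := by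
  induction h generalizing K' with
  | of_subset h => exact .of_subset (h.trans hK)
  | mul ha hb _ ih => exact .mul (hK ha) (hK hb) (ih (Set.insert_subset_insert hK))

theorem mono_right (h : Gen c K A) (hA : A' ⊆ A) : Gen c K A' := by
  induction h with
  | of_subset h => exact .of_subset (hA.trans h)
  | mul ha hb _ ih => exact .mul ha hb (ih hA)

theorem union_subset (h : Gen c K A) (hA : A' ⊆ K) : Gen c K (A' ∪ A) := by
  induction h with
  | of_subset h => exact .of_subset (Set.union_subset hA h)
  | mul ha hb _ ih => exact .mul ha hb (ih (hA.trans (Set.subset_insert _ _)))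

theorem bind (h : Gen c K A) (h' : Gen d (K ∪ A) A') : Gen (c + d) K (A ∪ A') := by
  induction h with
  | @of_subset c K A h =>
    rw [Set.union_eq_left.2 h] at h'
    exact (h'.union_subset h).mono_cost (by omega)
  | @mul c K A a b ha hb _ ih =>
    rw [show c + 1 + d = c + d + 1 by omega]
    exact .mul ha hb (ih (h'.mono_left (Set.union_subset_union_left _ (Set.subset_insert _ _))))

theorem trans (h : Gen c K A) (h' : Gen d A A') : Gen (c + d) K A' :=
  (h.bind (h'.mono_left Set.subset_union_right)).mono_right Set.subset_union_right

theorem union (h : Gen c K A) (h' : Gen d K A') : Gen (c + d) K (A ∪ A') :=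
  h.bind (h'.mono_left Set.subset_union_left)

theorem biUnion {ι : Type*} (s : Finset ι) (w : ι → ℕ) (T : ι → Set M)
    (h : ∀ i ∈ s, Gen (w i) K (T i)) : Gen (∑ i ∈ s, w i) K (⋃ i ∈ s, T i) := by
  classical
  induction s using Finset.induction_on with
  | empty => exact .of_subset (by simp)
  | insert i s hi ih =>
    rw [Finset.sum_insert hi, Finset.set_biUnion_insert]
    exact (h i (by simp)).union (ih fun j hj => h j (by simp [hj]))

theorem mul_mem {a b : M} (ha : a ∈ K) (hb : b ∈ K) : Gen 1 K {a * b} :=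
  .mul ha hb (.of_subset (by simp))

theorem map (φ : M →ₙ* N) (h : Gen c K A) : Gen c (φ '' K) (φ '' A) := by
  induction h with
  | of_subset h => exact .of_subset (Set.image_mono h)
  | mul ha hb _ ih =>
    rw [Set.image_insert_eq, map_mul] at ih
    exact .mul (Set.mem_image_of_mem _ ha) (Set.mem_image_of_mem _ hb) ih

end Gen

/-- `Reach Q c S K`: knowing that the secret lies in `S` and holding the values at the secret of the
functions in `K`, at most `c` multiplications and any number of equality tests lead to a set of
candidates that satisfies `Q`. -/
inductive Reach {X G : Type*} [Mul G] (Q : Set X → Prop) : ℕ → Set X → Set (X → G) → Prop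
  | done {c : ℕ} {S : Set X} {K : Set (X → G)} (h : Q S) : Reach Q c S K
  | mul {c : ℕ} {S : Set X} {K : Set (X → G)} {f g : X → G} (hf : f ∈ K) (hg : g ∈ K)
      (h : Reach Q c S (insert (f * g) K)) : Reach Q (c + 1) S K
  | split {c : ℕ} {S : Set X} {K : Set (X → G)} {f g : X → G} (hf : f ∈ K) (hg : g ∈ K)
      (h₁ : Reach Q c (S ∩ {x | f x = g x}) K) (h₂ : Reach Q c (S ∩ {x | f x ≠ g x}) K) :
      Reach Q c S K

namespace Reach

variable {X G : Type*} [Mul G] {Q R : Set X → Prop} {c d : ℕ} {S : Set X} {K : Set (X → G)}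

theorem mono_cost (h : Reach Q c S K) (hcd : c ≤ d) : Reach Q d S K := by
  induction h generalizing d with
  | done h => exact .done h
  | mul hf hg _ ih =>
    obtain ⟨d, rfl⟩ : ∃ d', d = d' + 1 := ⟨d - 1, by omega⟩
    exact .mul hf hg (ih (by omega))
  | split hf hg _ _ ih₁ ih₂ => exact .split hf hg (ih₁ hcd) (ih₂ hcd)

theorem bind (h : Reach Q c S K)
    (h' : ∀ S' K', S' ⊆ S → K ⊆ K' → Q S' → Reach R d S' K') : Reach R (c + d) S K := by
  induction h with
  | done h => exact (h' _ _ subset_rfl subset_rfl h).mono_cost (by omega)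
  | @mul c S K f g hf hg _ ih =>
    rw [show c + 1 + d = c + d + 1 by omega]
    exact .mul hf hg (ih fun S' K' hS hK hQ => h' S' K' hS ((Set.subset_insert _ _).trans hK) hQ)
  | split hf hg _ _ ih₁ ih₂ =>
    exact .split hf hg (ih₁ fun S' K' hS => h' S' K' (hS.trans Set.inter_subset_left))
      (ih₂ fun S' K' hS => h' S' K' (hS.trans Set.inter_subset_left))

theorem of_gen {A : Set (X → G)} (h : Gen c K A)
    (h' : ∀ K', K ⊆ K' → A ⊆ K' → Reach Q d S K') : Reach Q (c + d) S K := by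
  induction h with
  | of_subset h => exact (h' _ subset_rfl h).mono_cost (by omega)
  | @mul c K A f g hf hg _ ih =>
    rw [show c + 1 + d = c + d + 1 by omega]
    exact .mul hf hg (ih fun K' hK => h' K' ((Set.subset_insert _ _).trans hK))

/-- Testing finitely many pairs of known functions for equality is free. -/
theorem decide_pairs (l : List ((X → G) × (X → G))) (hl : ∀ q ∈ l, q.1 ∈ K ∧ q.2 ∈ K) :
    Reach (fun S' => ∀ q ∈ l, (∀ x ∈ S', q.1 x = q.2 x) ∨ (∀ x ∈ S', q.1 x ≠ q.2 x)) 0 S K := by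
  induction l with
  | nil => exact .done (by simp)
  | cons q l ih =>
    refine (ih fun q hq => hl q (by simp [hq])).bind (d := 0) fun S' K' _ hK hQ => ?_
    have hq := hl q (by simp)
    refine .split (hK hq.1) (hK hq.2) (.done ?_) (.done ?_)
    · rintro q' (_ | ⟨_, hq'⟩)
      · exact .inl fun x hx => hx.2
      · exact (hQ q' hq').imp (fun h x hx => h x hx.1) (fun h x hx => h x hx.1)
    · rintro q' (_ | ⟨_, hq'⟩)
      · exact .inr fun x hx => hx.2
      · exact (hQ q' hq').imp (fun h x hx => h x hx.1) (fun h x hx => h x hx.1)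

end Reach

/-- The equality pattern of a list: every entry is replaced by its first position. -/
def pattern {T : Type*} [DecidableEq T] (L : List T) : List ℕ := L.map fun x => L.idxOf x

section pattern

variable {T U : Type*} [DecidableEq T] [DecidableEq U]

@[simp] theorem length_pattern (L : List T) : (pattern L).length = L.length := by simp [pattern]

theorem pattern_map (φ : T → U) (L : List T) (hφ : Set.InjOn φ {x | x ∈ L}) :
    pattern (L.map φ) = pattern L := by
  have key : ∀ (L' : List T) (x : T), (∀ y ∈ L', φ y = φ x → y = x) →
      (L'.map φ).idxOf (φ x) = L'.idxOf x := by
    intro L' x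
    induction L' with
    | nil => simp
    | cons y L' ih =>
      intro h
      rw [List.map_cons, List.idxOf_cons, List.idxOf_cons]
      have h1 := h y (by simp)
      have h2 := ih fun z hz => h z (by simp [hz])
      by_cases hyx : y = x
      · subst hyx; simp
      · have : φ y ≠ φ x := fun h => hyx (h1 h)
        rw [beq_eq_false_iff_ne.2 this, beq_eq_false_iff_ne.2 hyx, h2]
  simp only [pattern, List.map_map]
  refine List.map_congr_left fun x hx => key L x fun y hy h => hφ hy hx h

theorem pattern_getElem?_eq_iff {L L' : List T} (h : L <+: L') {i j : ℕ} {x y : T}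
    (hi : L[i]? = some x) (hj : L[j]? = some y) :
    (pattern L')[i]? = (pattern L')[j]? ↔ x = y := by
  obtain ⟨M, rfl⟩ := h
  have hi' : (L ++ M)[i]? = some x := by
    rw [List.getElem?_append_left (List.getElem?_eq_some_iff.1 hi).1, hi]
  have hj' : (L ++ M)[j]? = some y := by
    rw [List.getElem?_append_left (List.getElem?_eq_some_iff.1 hj).1, hj]
  simp only [pattern, List.getElem?_map, hi', hj', Option.map_some, Option.some.injEq]
  refine List.idxOf_inj (List.mem_of_getElem? hi')

end pattern

/-- A move of a strategy: multiply two entries of the list of known elements, or halt. -/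
abbrev Move := (ℕ × ℕ) ⊕ List ℕ

open Classical in
/-- The strategy `F`, which sees the equality pattern of the elements received, halts with output
`x` after at most `t` multiplications when started on the list `L`. -/
inductive Runs {G : Type*} [Mul G] (F : List ℕ → Move) : ℕ → List G → List ℕ → Prop
  | out {t : ℕ} {L : List G} {x : List ℕ} (h : F (pattern L) = .inr x) : Runs F t L x
  | mul {t : ℕ} {L : List G} {x : List ℕ} {i j : ℕ} {g g' : G} (h : F (pattern L) = .inl (i, j))
      (hi : L[i]? = some g) (hj : L[j]? = some g') (hr : Runs F t (L ++ [g * g']) x) :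
      Runs F (t + 1) L x

section Runs

variable {G : Type*} [Mul G]

open Classical in
theorem Runs.congr {F F' : List ℕ → Move} {t : ℕ} {L : List G} {x : List ℕ} (h : Runs F t L x)
    (hF : ∀ L', L <+: L' → F' (pattern L') = F (pattern L')) : Runs F' t L x := by
  induction h with
  | out h => exact .out ((hF _ (List.prefix_refl _)).trans h)
  | mul h hi hj _ ih =>
    exact .mul ((hF _ (List.prefix_refl _)).trans h) hi hj
      (ih fun L' hL' => hF L' ((List.prefix_append _ _).trans hL'))

open Classical in
theorem Runs.exists_finset {F : List ℕ → Move} {t : ℕ} {L : List G} {x : List ℕ}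
    (h : Runs F t L x) : ∃ P : Finset (List ℕ), ∀ F' : List ℕ → Move,
      (∀ w ∈ P, F' w = F w) → Runs F' t L x := by
  induction h with
  | @out t L x h => exact ⟨{pattern L}, fun F' hF' => .out ((hF' _ (by simp)).trans h)⟩
  | @mul t L x i j g g' h hi hj _ ih =>
    obtain ⟨P, hP⟩ := ih
    exact ⟨insert (pattern L) P, fun F' hF' => .mul ((hF' _ (by simp)).trans h) hi hj
      (hP F' fun w hw => hF' w (by simp [hw]))⟩

open Classical in
theorem Reach.exists_strategy {X : Type*} (out : X → List ℕ) {c : ℕ} {S : Set X}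
    {K : Set (X → G)} (h : Reach Set.Subsingleton c S K) (Ls : List (X → G))
    (hK : ∀ f ∈ K, f ∈ Ls) :
    ∃ F : List ℕ → Move, ∀ β ∈ S, Runs F c (Ls.map fun f => f β) (out β) := by
  induction h generalizing Ls with
  | @done c S K h =>
    rcases S.eq_empty_or_nonempty with rfl | ⟨β, hβ⟩
    · exact ⟨fun _ => .inr [], by simp⟩
    · refine ⟨fun _ => .inr (out β), fun β' hβ' => ?_⟩
      rw [h hβ' hβ]
      exact .out rfl
  | @mul c S K f g hf hg _ ih =>
    obtain ⟨F, hF⟩ := ih (Ls ++ [f * g]) (by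
      rintro u (rfl | hu)
      · simp
      · simp [hK u hu])
    obtain ⟨i, hi⟩ := List.getElem?_of_mem (hK f hf)
    obtain ⟨j, hj⟩ := List.getElem?_of_mem (hK g hg)
    refine ⟨fun w => if w.length = Ls.length then .inl (i, j) else F w, fun β hβ => ?_⟩
    refine .mul (g := f β) (g' := g β) (i := i) (j := j) (by simp) (by simp [hi]) (by simp [hj]) ?_
    have := hF β hβ
    rw [List.map_append] at this
    refine this.congr fun L' hL' => ?_
    have := hL'.length_le
    simp only [List.map_cons, List.map_nil, List.length_append, List.length_map, List.length_cons,
      List.length_nil] at this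
    rw [if_neg]
    rw [length_pattern]
    omega
  | @split c S K f g hf hg _ _ ih₁ ih₂ =>
    obtain ⟨F₁, hF₁⟩ := ih₁ Ls hK
    obtain ⟨F₂, hF₂⟩ := ih₂ Ls hK
    obtain ⟨i, hi⟩ := List.getElem?_of_mem (hK f hf)
    obtain ⟨j, hj⟩ := List.getElem?_of_mem (hK g hg)
    refine ⟨fun w => if w[i]? = w[j]? then F₁ w else F₂ w, fun β hβ => ?_⟩
    have hi' : (Ls.map fun f => f β)[i]? = some (f β) := by simp [hi]
    have hj' : (Ls.map fun f => f β)[j]? = some (g β) := by simp [hj]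
    by_cases hfg : f β = g β
    · refine (hF₁ β ⟨hβ, hfg⟩).congr fun L' hL' => ?_
      rw [if_pos ((pattern_getElem?_eq_iff hL' hi' hj').2 hfg)]
    · refine (hF₂ β ⟨hβ, hfg⟩).congr fun L' hL' => ?_
      rw [if_neg fun h => hfg ((pattern_getElem?_eq_iff hL' hi' hj').1 h)]

/-- The strategy given by a finite table. -/
def tableMove (τ : List (List ℕ × Move)) (w : List ℕ) : Move := (τ.lookup w).getD (.inr [])

theorem exists_table_eqOn (F : List ℕ → Move) (P : Finset (List ℕ)) :
    ∃ τ : List (List ℕ × Move), ∀ w ∈ P, tableMove τ w = F w := by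
  refine ⟨P.toList.map fun w => (w, F w), fun w hw => ?_⟩
  suffices h : ∀ l : List (List ℕ), w ∈ l → (l.map fun w => (w, F w)).lookup w = some (F w) by
    rw [tableMove, h _ (by simpa using hw), Option.getD_some]
  intro l hl
  induction l with
  | nil => simp at hl
  | cons v l ih =>
    rw [List.map_cons, List.lookup_cons]
    by_cases hv : w = v
    · subst hv; simp
    · rw [beq_eq_false_iff_ne.2 hv]
      exact ih (by simpa [hv] using hl)

theorem exists_table {X : Type*} [Finite X] {F : List ℕ → Move} {t : ℕ}
    {L : X → List G} {out : X → List ℕ} (h : ∀ β, Runs F t (L β) (out β)) :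
    ∃ τ : List (List ℕ × Move), ∀ β, Runs (tableMove τ) t (L β) (out β) := by
  classical
  cases nonempty_fintype X
  choose P hP using fun β => (h β).exists_finset
  obtain ⟨τ, hτ⟩ := exists_table_eqOn F (Finset.univ.biUnion P)
  exact ⟨τ, fun β => hP β _ fun w hw => hτ w (by simpa using ⟨β, hw⟩)⟩

end Runs

namespace Gen

variable {M : Type*} [CommMonoid M] {K : Set M}

theorem pow {x : M} (hx : x ∈ K) {n : ℕ} (hn : n ≠ 0) : Gen (2 * Nat.log 2 n) K {x ^ n} := by
  induction n using Nat.strong_induction_on with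
  | _ n ih =>
    rcases Nat.lt_or_ge n 2 with h | h
    · obtain rfl : n = 1 := by omega
      exact .of_subset (by simpa using hx)
    · have h1 := ih (n / 2) (by omega) (by omega)
      have hlog : Nat.log 2 n = Nat.log 2 (n / 2) + 1 := by
        rw [Nat.log_div_base]
        have : 0 < Nat.log 2 n := Nat.log_pos (by norm_num) h
        omega
      have h2 : Gen 1 {x ^ (n / 2)} {x ^ (n / 2) * x ^ (n / 2)} := mul_mem (by simp) (by simp)
      rw [← pow_add] at h2
      have h3 := h1.trans h2
      rcases Nat.mod_two_eq_zero_or_one n with h0 | h0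
      · rw [show n / 2 + n / 2 = n by omega] at h3
        exact h3.mono_cost (by omega)
      · have h4 : Gen 1 (K ∪ {x ^ (n / 2 + n / 2)}) {x ^ (n / 2 + n / 2) * x} :=
          mul_mem (by simp) (.inl hx)
        rw [← pow_succ, show n / 2 + n / 2 + 1 = n by omega] at h4
        exact ((h3.bind h4).mono_right Set.subset_union_right).mono_cost (by omega)

theorem iterate_pow {x : M} (hx : x ∈ K) {n : ℕ} (hn : n ≠ 0) (t : ℕ) :
    Gen (t * (2 * Nat.log 2 n)) K {y | ∃ u ≤ t, y = x ^ n ^ u} := by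
  induction t with
  | zero => exact .of_subset (by rintro y ⟨u, hu, rfl⟩; obtain rfl := Nat.le_zero.1 hu; simpa)
  | succ t ih =>
    have h1 : Gen (2 * Nat.log 2 n) (K ∪ {y | ∃ u ≤ t, y = x ^ n ^ u}) {(x ^ n ^ t) ^ n} :=
      pow (.inr ⟨t, le_rfl, rfl⟩) hn
    refine ((ih.bind h1).mono_cost (by ring_nf; rfl)).mono_right ?_
    rintro y ⟨u, hu, rfl⟩
    rcases Nat.lt_or_ge t u with h | h
    · obtain rfl : u = t + 1 := by omega
      right
      rw [← pow_mul, ← pow_succ]; rfl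
    · exact .inl ⟨u, h, rfl⟩

theorem doublings {x : M} (hx : x ∈ K) (t : ℕ) : Gen t K {y | ∃ l ≤ t, y = x ^ 2 ^ l} := by
  induction t with
  | zero => exact .of_subset (by rintro y ⟨u, hu, rfl⟩; obtain rfl := Nat.le_zero.1 hu; simpa)
  | succ t ih =>
    have h1 : Gen 1 (K ∪ {y | ∃ u ≤ t, y = x ^ 2 ^ u}) {x ^ 2 ^ t * x ^ 2 ^ t} :=
      mul_mem (.inr ⟨t, le_rfl, rfl⟩) (.inr ⟨t, le_rfl, rfl⟩)
    refine (ih.bind h1).mono_right ?_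
    rintro y ⟨u, hu, rfl⟩
    rcases Nat.lt_or_ge t u with h | h
    · obtain rfl : u = t + 1 := by omega
      right
      rw [← pow_add, pow_succ, mul_two]; rfl
    · exact .inl ⟨u, h, rfl⟩

theorem mul_prod {ι : Type*} {b : M} (hb : b ∈ K) (s : Finset ι) (g : ι → M)
    (hg : ∀ i ∈ s, g i ∈ K) : Gen s.card K {b * ∏ i ∈ s, g i} := by
  classical
  induction s using Finset.induction_on with
  | empty => exact .of_subset (by simpa)
  | insert i s hi ih =>
    rw [Finset.card_insert_of_notMem hi, Finset.prod_insert hi]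
    have h1 := (ih fun j hj => hg j (by simp [hj])).bind
      (mul_mem (a := b * ∏ i ∈ s, g i) (b := g i) (by simp) (.inl (hg i (by simp))))
    rw [show b * (g i * ∏ i ∈ s, g i) = b * (∏ i ∈ s, g i) * g i by
      rw [mul_assoc, mul_comm (g i)]]
    exact h1.mono_right Set.subset_union_right

/-- Yao's method: a product of `q` powers with exponents below `m` costs at most `q + m`. -/
theorem multiexp {ι : Type*} (s : Finset ι) (h1 : (1 : M) ∈ K) (m : ℕ) (c : ι → ℕ) (g : ι → M)
    (hg : ∀ i ∈ s, g i ∈ K) (hc : ∀ i ∈ s, c i < m) :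
    Gen (s.card + m) K {∏ i ∈ s, g i ^ c i} := by
  classical
  suffices h : ∀ (m : ℕ) (c : ι → ℕ), (∀ i ∈ s, c i < m) →
      Gen ((s.filter (1 ≤ c ·)).card + m) K
        {∏ i ∈ s, g i ^ c i, ∏ i ∈ s with 1 ≤ c i, g i} from
    ((h m c hc).mono_right (by simp)).mono_cost
      (Nat.add_le_add_right (Finset.card_filter_le _ _) _)
  clear hc c m
  intro m
  induction m with
  | zero =>
    intro c hc
    have hs : s = ∅ := Finset.eq_empty_of_forall_notMem fun i hi => by have := hc i hi; omega
    subst hs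
    exact .of_subset (by simpa)
  | succ m ih =>
    intro c hc
    by_cases hm : m = 0
    · subst hm
      have h0 : ∀ i ∈ s, c i = 0 := fun i hi => by have := hc i hi; omega
      have e1 : ∏ i ∈ s, g i ^ c i = 1 := Finset.prod_eq_one fun i hi => by simp [h0 i hi]
      have e2 : s.filter (1 ≤ c ·) = ∅ := Finset.filter_eq_empty_iff.2 fun i hi => by
        simp [h0 i hi]
      rw [e1, e2]
      exact .of_subset (by simpa)
    have ih' := ih (fun i => c i - 1) fun i hi => by have := hc i hi; omega
    set s₁ := s.filter (1 ≤ c ·) with hs₁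
    set s₂ := s.filter (1 ≤ c · - 1) with hs₂
    have hsub : s₂ ⊆ s₁ := fun i hi => by
      simp only [hs₁, hs₂, Finset.mem_filter] at hi ⊢
      exact ⟨hi.1, by omega⟩
    have h2 : Gen (s₁ \ s₂).card (K ∪ {∏ i ∈ s, g i ^ (c i - 1), ∏ i ∈ s₂, g i})
        {(∏ i ∈ s₂, g i) * ∏ i ∈ s₁ \ s₂, g i} :=
      mul_prod (by simp) _ _ fun i hi => .inl (hg i (by simp [hs₁] at hi; exact hi.1.1))
    rw [mul_comm, Finset.prod_sdiff hsub] at h2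
    have h3 := ih'.bind h2
    have h4 := h3.bind (mul_mem (a := ∏ i ∈ s, g i ^ (c i - 1)) (b := ∏ i ∈ s₁, g i)
      (by simp) (by simp))
    have hprod : (∏ i ∈ s, g i ^ (c i - 1)) * ∏ i ∈ s₁, g i = ∏ i ∈ s, g i ^ c i := by
      rw [hs₁, Finset.prod_filter, ← Finset.prod_mul_distrib]
      refine Finset.prod_congr rfl fun i _ => ?_
      split_ifs with h
      · rw [← pow_succ, Nat.sub_add_cancel h]
      · rw [show c i = 0 by omega]; simp
    rw [hprod] at h4
    refine (h4.mono_cost ?_).mono_right ?_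
    · have := Finset.card_sdiff_add_card_eq_card hsub
      omega
    · rintro x (rfl | rfl)
      · simp
      · simp

/-- Adjoining the powers `g ^ 0, …, g ^ q` as factors to a finite set of known elements. -/
theorem mul_powers [DecidableEq M] (A : Finset M) (hA : ↑A ⊆ K) {g : M} (hg : g ∈ K) (q : ℕ) :
    Gen (q * A.card) K
      ((Finset.range (q + 1) ×ˢ A).image fun x => x.2 * g ^ x.1 : Finset M) := by
  induction q with
  | zero => exact .of_subset (by intro x; simp; exact fun hx => hA hx)
  | succ q ih =>
    have h2 : Gen (∑ x ∈ A, 1) (K ∪ ((Finset.range (q + 1) ×ˢ A).image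
        fun x => x.2 * g ^ x.1 : Finset M)) (⋃ x ∈ A, {x * g ^ q * g}) :=
      biUnion A (fun _ => 1) _ fun x hx => mul_mem (.inr (by
        simp only [Finset.coe_image, Set.mem_image, SetLike.mem_coe, Finset.mem_product,
          Finset.mem_range, Prod.exists]
        exact ⟨q, x, ⟨by omega, hx⟩, rfl⟩)) (.inl hg)
    refine ((ih.bind h2).mono_cost (by simp [add_mul])).mono_right ?_
    intro y
    simp only [Finset.coe_image, Set.mem_image, SetLike.mem_coe, Finset.mem_product,
      Finset.mem_range, Prod.exists, Set.mem_union, Set.mem_iUnion, Set.mem_singleton_iff]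
    rintro ⟨u, x, ⟨hu, hx⟩, rfl⟩
    rcases Nat.lt_or_ge u (q + 1) with h | h
    · exact .inl ⟨u, x, ⟨h, hx⟩, rfl⟩
    · obtain rfl : u = q + 1 := by omega
      exact .inr ⟨x, hx, by rw [pow_succ, mul_assoc]⟩

end Gen

section BabyStepGiantStep

variable {X G : Type*} [CommGroup G]

/-- Baby steps `f * b` and giant steps `a`. -/
theorem Reach.babyStepGiantStep {S : Set X} {K : Set (X → G)} {f : X → G} (hf : f ∈ K)
    (A B : Finset G) (hA : ∀ a ∈ A, (fun _ => a) ∈ K) (hB : ∀ b ∈ B, (fun _ => b) ∈ K)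
    (h : ∀ x ∈ S, ∃ a ∈ A, ∃ b ∈ B, f x * b = a) :
    Reach (fun S' => ∀ x ∈ S', ∀ y ∈ S', f x = f y) B.card S K := by
  have h1 : Gen (∑ b ∈ B, 1) K (⋃ b ∈ B, {f * fun _ => b}) :=
    Gen.biUnion B (fun _ => 1) _ fun b hb => Gen.mul_mem hf (hB b hb)
  have h2 : Reach (fun S' => ∀ x ∈ S', ∀ y ∈ S', f x = f y) (∑ b ∈ B, 1 + 0) S K := by
    refine Reach.of_gen h1 fun K' hK hK' => ?_
    refine (Reach.decide_pairs ((A ×ˢ B).toList.map fun q =>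
      ((f * fun _ => q.2 : X → G), (fun _ => q.1 : X → G))) ?_).bind (d := 0)
      fun S' K'' hS _ hQ => .done fun x hx y hy => ?_
    · simp only [List.mem_map, Finset.mem_toList, Finset.mem_product]
      rintro _ ⟨⟨a, b⟩, ⟨ha, hb⟩, rfl⟩
      exact ⟨hK' (by simp only [Set.mem_iUnion]; exact ⟨b, hb, rfl⟩), hK (hA a ha)⟩
    · obtain ⟨a, ha, b, hb, hab⟩ := h x (hS hx)
      have := hQ ((f * fun _ => b : X → G), (fun _ => a : X → G)) (by
        simp only [List.mem_map, Finset.mem_toList, Finset.mem_product]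
        exact ⟨(a, b), ⟨ha, hb⟩, rfl⟩)
      rcases this with h | h
      · have hy := h y hy
        simp only [Pi.mul_apply] at hy
        exact mul_right_cancel (hab.trans hy.symm)
      · exact absurd hab (h x hx)
  simpa using h2

theorem Nat.mul_sqrt_le_sqrt_sq_mul (p n : ℕ) : p * Nat.sqrt n ≤ Nat.sqrt (p ^ 2 * n) := by
  rw [Nat.le_sqrt]
  calc p * n.sqrt * (p * n.sqrt) = p ^ 2 * (n.sqrt * n.sqrt) := by ring
    _ ≤ p ^ 2 * n := Nat.mul_le_mul_left _ (Nat.sqrt_le n)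

/-- Sets of baby and giant steps for an elementary abelian group with given generators. -/
theorem exists_babyGiantSets {ι : Type*} [DecidableEq ι] [DecidableEq G] {p : ℕ} (hp : 2 ≤ p)
    (γ : ι → G) (hγ : ∀ i, γ i ^ p = 1) :
    ∀ (ρ : ℕ) (I : Finset ι), I.card = ρ → ∃ A B : Finset G,
      A.card ≤ 3 * Nat.sqrt (p ^ ρ) ∧ B.card ≤ 3 * Nat.sqrt (p ^ ρ) ∧
      Gen (6 * Nat.sqrt (p ^ ρ)) (insert 1 (γ '' I)) ↑A ∧
      Gen (6 * Nat.sqrt (p ^ ρ)) (insert 1 (γ '' I)) ↑B ∧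
      ∀ c : ι → ℕ, ∃ a ∈ A, ∃ b ∈ B, (∏ i ∈ I, γ i ^ c i) * b = a := by
  intro ρ
  have hmod : ∀ (i : ι) (n : ℕ), γ i ^ (n % p) = γ i ^ n := fun i n =>
    (pow_eq_pow_mod n (hγ i)).symm
  induction ρ using Nat.twoStepInduction with
  | zero =>
    intro I hI
    obtain rfl := Finset.card_eq_zero.1 hI
    exact ⟨{1}, {1}, by simp, by simp, .of_subset (by simp), .of_subset (by simp), by simp⟩
  | one =>
    intro I hI
    obtain ⟨i, rfl⟩ := Finset.card_eq_one.1 hI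
    set d := Nat.sqrt p + 1 with hd
    have hs : 1 ≤ Nat.sqrt p := Nat.sqrt_pos.2 (by omega)
    have hpd : p < d * d := Nat.lt_succ_sqrt p
    rw [pow_one, Finset.coe_singleton, Set.image_singleton]
    have hmem : γ i ∈ (insert 1 {γ i} : Set G) := by simp
    have hB := Gen.mul_powers ({1} : Finset G) (K := insert 1 {γ i}) (by simp) hmem d
    have hA := hB.bind (Gen.mul_powers ({1} : Finset G) (g := γ i ^ d) (by simp)
      (.inr (by
        simp only [Finset.coe_image, Set.mem_image, SetLike.mem_coe, Finset.mem_product,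
          Finset.mem_range, Prod.exists]
        exact ⟨d, 1, ⟨by omega, by simp⟩, by simp⟩)) d)
    refine ⟨_, _, ?_, ?_, (hA.mono_cost ?_).mono_right Set.subset_union_right,
      hB.mono_cost ?_, fun c => ?_⟩
    · refine Finset.card_image_le.trans ?_
      simp; omega
    · refine Finset.card_image_le.trans ?_
      simp; omega
    · simp; omega
    · simp; omega
    · have hn : c i % p < p := Nat.mod_lt _ (by omega)
      set n := c i % p with hn'
      have hdm := Nat.div_add_mod n d
      have hnd : n % d < d := Nat.mod_lt _ (by omega)
      have hlt : n / d < d := Nat.div_lt_of_lt_mul (hn.trans hpd)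
      simp only [Finset.mem_image, Finset.mem_product, Finset.mem_range, Prod.exists,
        Finset.mem_singleton, Finset.prod_singleton]
      refine ⟨_, ⟨n / d + 1, 1, ⟨by omega, rfl⟩, rfl⟩, _, ⟨d - n % d, 1, ⟨by omega, rfl⟩, rfl⟩, ?_⟩
      rw [← hmod, ← hn', one_mul, one_mul, ← pow_add, ← pow_mul]
      congr 1
      rw [mul_add]
      omega
  | more ρ ih _ =>
    intro I hI
    obtain ⟨i, I₁, hi, rfl, hI₁⟩ := Finset.card_eq_succ.1 hI
    obtain ⟨j, I₂, hj, rfl, hI₂⟩ := Finset.card_eq_succ.1 hI₁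
    obtain ⟨A, B, hA, hB, hGA, hGB, hAB⟩ := ih I₂ hI₂
    have hsq : p * Nat.sqrt (p ^ ρ) ≤ Nat.sqrt (p ^ (ρ + 2)) := by
      rw [pow_add, mul_comm (p ^ ρ)]
      exact Nat.mul_sqrt_le_sqrt_sq_mul _ _
    set Y := Nat.sqrt (p ^ ρ)
    set K : Set G := insert 1 (γ '' ↑(insert i (insert j I₂))) with hK
    have hKsub : insert 1 (γ '' ↑I₂) ⊆ K := by
      refine Set.insert_subset_insert (Set.image_mono ?_)
      intro x hx
      simp only [Finset.coe_insert, Set.mem_insert_iff]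
      exact .inr (.inr hx)
    have hiK : γ i ∈ K := .inr ⟨i, by simp, rfl⟩
    have hjK : γ j ∈ K := .inr ⟨j, by simp, rfl⟩
    obtain ⟨p, rfl⟩ : ∃ q, p = q + 1 := ⟨p - 1, by omega⟩
    have hA' := (hGA.mono_left hKsub).bind (Gen.mul_powers A (g := γ i) (by simp) (.inl hiK) p)
    have hB' := (hGB.mono_left hKsub).bind (Gen.mul_powers B (g := γ j) (by simp) (.inl hjK) p)
    have hcost : ∀ n, n ≤ 3 * Y → 6 * Y + p * n ≤ 6 * Nat.sqrt ((p + 1) ^ (ρ + 2)) := fun n hn => by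
      have h1 : p * n ≤ p * (3 * Y) := Nat.mul_le_mul_left _ hn
      nlinarith
    have hcard : ∀ n, n ≤ 3 * Y → (p + 1) * n ≤ 3 * Nat.sqrt ((p + 1) ^ (ρ + 2)) := fun n hn => by
      have h1 : (p + 1) * n ≤ (p + 1) * (3 * Y) := Nat.mul_le_mul_left _ hn
      nlinarith
    refine ⟨_, _, ?_, ?_, (hA'.mono_cost (hcost _ hA)).mono_right Set.subset_union_right,
      (hB'.mono_cost (hcost _ hB)).mono_right Set.subset_union_right, fun c => ?_⟩
    · refine Finset.card_image_le.trans ?_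
      rw [Finset.card_product, Finset.card_range]
      exact hcard _ hA
    · refine Finset.card_image_le.trans ?_
      rw [Finset.card_product, Finset.card_range]
      exact hcard _ hB
    · obtain ⟨a, ha, b, hb, hab⟩ := hAB c
      simp only [Finset.mem_image, Finset.mem_product, Finset.mem_range, Prod.exists]
      have hlt : ∀ n, n % (p + 1) < p + 1 := fun n => Nat.mod_lt _ (by omega)
      refine ⟨_, ⟨c i % (p + 1), a, ⟨hlt _, ha⟩, rfl⟩, _,
        ⟨(p * c j) % (p + 1), b, ⟨hlt _, hb⟩, rfl⟩, ?_⟩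
      rw [Finset.prod_insert hi, Finset.prod_insert hj, hmod, hmod, ← hab]
      have hj1 : γ j ^ c j * γ j ^ (p * c j) = 1 := by
        rw [← pow_add, show c j + p * c j = (p + 1) * c j by ring, pow_mul, hγ, one_pow]
      calc _ = γ j ^ c j * γ j ^ (p * c j) * (γ i ^ c i * ((∏ i ∈ I₂, γ i ^ c i) * b)) := by
              simp only [mul_assoc, mul_left_comm, mul_comm]
        _ = _ := by rw [hj1, one_mul, mul_comm]

end BabyStepGiantStep

/-- `y` is a product of at most `q` powers of elements of `K` with exponents below `m`. -/
def IsPowProd {M : Type*} [CommMonoid M] (K : Set M) (m q : ℕ) (y : M) : Prop :=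
  ∃ l : List (ℕ × M), l.length ≤ q ∧ (∀ x ∈ l, x.1 < m ∧ x.2 ∈ K) ∧
    (l.map fun x => x.2 ^ x.1).prod = y

namespace IsPowProd

variable {M : Type*} [CommMonoid M] {K : Set M} {m q q' : ℕ} {y y' : M}

theorem one : IsPowProd K m 0 1 := ⟨[], by simp⟩

theorem pow {d : ℕ} (hy : y ∈ K) (hd : d < m) : IsPowProd K m 1 (y ^ d) := ⟨[(d, y)], by simp [*]⟩

theorem mono (h : IsPowProd K m q y) (hq : q ≤ q') : IsPowProd K m q' y := by
  obtain ⟨l, h1, h2⟩ := h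
  exact ⟨l, h1.trans hq, h2⟩

theorem mul (h : IsPowProd K m q y) (h' : IsPowProd K m q' y') :
    IsPowProd K m (q + q') (y * y') := by
  obtain ⟨l, h1, h2, rfl⟩ := h
  obtain ⟨l', h1', h2', rfl⟩ := h'
  refine ⟨l ++ l', by simp; omega, fun x hx => ?_, by simp⟩
  rcases List.mem_append.1 hx with hx | hx
  exacts [h2 x hx, h2' x hx]

theorem prod {ι : Type*} (s : Finset ι) (w : ι → ℕ) (z : ι → M)
    (h : ∀ i ∈ s, IsPowProd K m (w i) (z i)) :
    IsPowProd K m (∑ i ∈ s, w i) (∏ i ∈ s, z i) := by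
  classical
  induction s using Finset.induction_on with
  | empty => simpa using one
  | insert i s hi ih =>
    rw [Finset.sum_insert hi, Finset.prod_insert hi]
    exact (h i (by simp)).mul (ih fun j hj => h j (by simp [hj]))

theorem gen (h : IsPowProd K m q y) (h1 : (1 : M) ∈ K) : Gen (q + m) K {y} := by
  obtain ⟨l, hl, h2, rfl⟩ := h
  have := Gen.multiexp (Finset.univ : Finset (Fin l.length)) h1 m (fun i => (l.get i).1)
    (fun i => (l.get i).2) (fun i _ => (h2 _ (List.get_mem _ _)).2)
    (fun i _ => (h2 _ (List.get_mem _ _)).1)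
  rw [Finset.card_univ, Fintype.card_fin] at this
  have e : ∏ i : Fin l.length, (l.get i).2 ^ (l.get i).1 = (l.map fun x => x.2 ^ x.1).prod := by
    rw [← List.prod_ofFn]
    congr 1
    apply List.ext_get <;> simp
  rw [e] at this
  exact this.mono_cost (by omega)

theorem pow_of_digits {R n : ℕ} (hR : 0 < R) {g : M} (q : ℕ)
    (h : ∀ l < q, ∀ d < R, IsPowProd K m n (g ^ (R ^ l * d))) {c : ℕ} (hc : c < R ^ q) :
    IsPowProd K m (q * n) (g ^ c) := by
  induction q generalizing c with
  | zero =>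
    obtain rfl : c = 0 := by simpa using hc
    simpa using one
  | succ q ih =>
    have h1 := ih (fun l hl => h l (by omega)) (Nat.mod_lt c (pow_pos hR q))
    have h2 := h q (by omega) (c / R ^ q)
      (Nat.div_lt_of_lt_mul (by rwa [pow_succ] at hc))
    have h3 := h1.mul h2
    rw [← pow_add, Nat.mod_add_div] at h3
    exact h3.mono (by rw [add_mul, one_mul])

theorem pow_of_windows {p : ℕ} (hp : 2 ≤ p) {g : M} {n w : ℕ} (hw : 1 ≤ w) (hwn : w ≤ n)
    (hK : ∀ v < n, ∀ l ≤ Nat.log 2 p, g ^ (p ^ v * 2 ^ l) ∈ K) {c : ℕ} (hc : c < p ^ n) :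
    ∃ q, q * w ≤ 5 * Nat.log 2 p * n ∧ IsPowProd K (2 ^ w) q (g ^ c) := by
  set L := Nat.log 2 p with hL
  have hL1 : 1 ≤ L := Nat.log_pos (by norm_num) hp
  have hpL : p < 2 ^ (L + 1) := Nat.lt_pow_succ_log_self (by norm_num) p
  rcases Nat.lt_or_ge L w with h | h
  · set a := w / (L + 1) with ha
    have ha1 : 1 ≤ a := (Nat.one_le_div_iff (by omega)).2 h
    have haw : (L + 1) * a ≤ w := Nat.mul_div_le w (L + 1)
    have hwa : w < (L + 1) * (a + 1) := Nat.lt_mul_div_succ w (by omega)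
    have hpa : p ^ a ≤ 2 ^ w := calc
      p ^ a ≤ (2 ^ (L + 1)) ^ a := Nat.pow_le_pow_left hpL.le a
      _ = 2 ^ ((L + 1) * a) := (pow_mul _ _ _).symm
      _ ≤ 2 ^ w := Nat.pow_le_pow_right (by norm_num) haw
    have hdiv : a * ((n - 1) / a) ≤ n - 1 := Nat.mul_div_le _ _
    have hdiv' : n - 1 < a * ((n - 1) / a + 1) := Nat.lt_mul_div_succ _ (by omega)
    refine ⟨((n - 1) / a + 1) * 1, ?_, pow_of_digits (R := p ^ a) (by positivity) _ ?_ ?_⟩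
    · have h1 : w ≤ 4 * a * L := by nlinarith
      have h2 : (n - 1) / a * w ≤ (n - 1) / a * (4 * a * L) := Nat.mul_le_mul_left _ h1
      have h3 : a * ((n - 1) / a) * (4 * L) ≤ n * (4 * L) :=
        Nat.mul_le_mul_right _ (hdiv.trans (by omega))
      have h4 : w ≤ L * n := hwn.trans (Nat.le_mul_of_pos_left _ hL1)
      nlinarith
    · intro l hl d hd
      rw [← pow_mul, pow_mul g]
      refine IsPowProd.pow ?_ (hd.trans_le hpa)
      have := hK (a * l) (by
        have : a * l ≤ a * ((n - 1) / a) := Nat.mul_le_mul_left _ (by omega)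
        omega) 0 (by omega)
      simpa using this
    · refine hc.trans_le ?_
      rw [← pow_mul]
      exact Nat.pow_le_pow_right (by omega) (by omega)
  · refine ⟨n * ((L / w + 1) * 1), ?_, pow_of_digits (R := p) (by omega) _ ?_ hc⟩
    · have : L / w * w ≤ L := Nat.div_mul_le_self L w
      calc n * ((L / w + 1) * 1) * w = n * (L / w * w + w) := by ring
        _ ≤ n * (5 * L) := Nat.mul_le_mul_left _ (by omega)
        _ = _ := by ring
    · intro v hv d hd
      rw [pow_mul]
      refine pow_of_digits (R := 2 ^ w) (by positivity) _ ?_ ?_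
      · intro l hl d' hd'
        rw [show (g ^ p ^ v) ^ ((2 ^ w) ^ l * d') = (g ^ (p ^ v * 2 ^ (w * l))) ^ d' by
          rw [← pow_mul g, ← pow_mul g, ← pow_mul 2, mul_assoc]]
        refine IsPowProd.pow (hK v hv (w * l) ?_) hd'
        calc w * l ≤ w * (L / w) := Nat.mul_le_mul_left _ (by omega)
          _ ≤ L := Nat.mul_div_le L w
      · rw [← pow_mul]
        refine (hd.trans hpL).trans_le (Nat.pow_le_pow_right (by norm_num) ?_)
        exact Nat.lt_mul_div_succ L (by omega)

end IsPowProd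

section Basis

variable {G : Type*} [CommGroup G] {k : ℕ} {α : Fin k → G}

theorem IsGroupBasis.orderOf_pos (hα : IsGroupBasis α) (i : Fin k) : 0 < orderOf (α i) := by
  obtain ⟨x, hx, -⟩ := hα 1
  exact (Nat.zero_le _).trans_lt (hx.1 i)

theorem IsGroupBasis.prod_pow_eq_iff (hα : IsGroupBasis α) (x y : Fin k → ℕ) :
    ∏ i, α i ^ x i = ∏ i, α i ^ y i ↔ ∀ i, x i ≡ y i [MOD orderOf (α i)] := by
  have key : ∀ x : Fin k → ℕ,
      IsDiscreteLog α (∏ i, α i ^ x i) fun i => x i % orderOf (α i) := fun x =>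
    ⟨fun i => Nat.mod_lt _ (hα.orderOf_pos i), by simp [pow_mod_orderOf]⟩
  refine ⟨fun h i => ?_, fun h => Finset.prod_congr rfl fun i _ => pow_eq_pow_iff_modEq.2 (h i)⟩
  have h1 := key x
  rw [h] at h1
  exact congrFun ((hα _).unique h1 (key y)) i

/-- The elements that are `p ^ s`-th powers and are killed by `p ^ h`. -/
def layer (G : Type*) [CommGroup G] (p s h : ℕ) : Set G :=
  {y | (∃ z, y = z ^ p ^ s) ∧ y ^ p ^ h = 1}

theorem pow_mem_layer {p s h t : ℕ} {y : G} (hy : y ∈ layer G p s h) (ht : t ≤ h) :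
    y ^ p ^ t ∈ layer G p (s + t) (h - t) := by
  obtain ⟨⟨z, rfl⟩, hz⟩ := hy
  refine ⟨⟨z, by rw [← pow_mul, ← pow_add]⟩, ?_⟩
  rw [← pow_mul, ← pow_add, Nat.add_sub_cancel' ht, hz]

theorem inv_mem_layer {p s h : ℕ} {y : G} (hy : y ∈ layer G p s h) : y⁻¹ ∈ layer G p s h := by
  obtain ⟨⟨z, rfl⟩, hz⟩ := hy
  exact ⟨⟨z⁻¹, by rw [inv_pow]⟩, by rw [inv_pow, hz, inv_one]⟩

variable {e : Fin k → ℕ} {p : ℕ}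

theorem IsGroupBasis.exists_coords (hα : IsGroupBasis α) (he : ∀ i, orderOf (α i) = p ^ e i)
    (hp : 2 ≤ p) {s h : ℕ} {y : G} (hy : y ∈ layer G p s h) :
    ∃ c : Fin k → ℕ, (∀ i, c i < p ^ (e i - max s (e i - h))) ∧
      y = ∏ i, α i ^ (p ^ max s (e i - h) * c i) := by
  obtain ⟨⟨z, hz⟩, hy1⟩ := hy
  obtain ⟨x, ⟨hx, hxy⟩, -⟩ := hα y
  obtain ⟨x', ⟨-, hxz⟩, -⟩ := hα z
  have h1 : ∀ i, x i ≡ p ^ s * x' i [MOD p ^ e i] := by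
    simp only [← he]
    rw [← hα.prod_pow_eq_iff, hxy, hz, ← hxz, ← Finset.prod_pow]
    exact Finset.prod_congr rfl fun i _ => by rw [← pow_mul, mul_comm]
  have h2 : ∀ i, p ^ h * x i ≡ 0 [MOD p ^ e i] := by
    simp only [← he]
    rw [← hα.prod_pow_eq_iff _ fun _ => 0]
    simp only [pow_zero, Finset.prod_const_one]
    rw [← hy1, ← hxy, ← Finset.prod_pow]
    exact Finset.prod_congr rfl fun i _ => by rw [← pow_mul, mul_comm]
  have h3 : ∀ i, p ^ max s (e i - h) ∣ x i := by
    intro i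
    rcases le_total s (e i - h) with hs | hs
    · rw [max_eq_right hs]
      rcases Nat.lt_or_ge (e i) h with hh | hh
      · rw [Nat.sub_eq_zero_of_le hh.le]; simp
      · have := (Nat.modEq_zero_iff_dvd.1 (h2 i))
        rw [← pow_mul_pow_sub p hh] at this
        exact Nat.dvd_of_mul_dvd_mul_left (by positivity) this
    · rw [max_eq_left hs]
      rcases Nat.lt_or_ge s (e i) with hh | hh
      · exact ((h1 i).dvd_iff (pow_dvd_pow p hh.le)).2 (dvd_mul_right _ _)
      · have h4 : x i ≡ 0 [MOD p ^ e i] := (h1 i).trans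
          (Nat.modEq_zero_iff_dvd.2 (Dvd.dvd.mul_right (pow_dvd_pow p hh) _))
        rw [Nat.eq_zero_of_dvd_of_lt (Nat.modEq_zero_iff_dvd.1 h4) (he i ▸ hx i)]
        exact dvd_zero _
  choose c hc using h3
  refine ⟨fun i => if max s (e i - h) ≤ e i then c i else 0, fun i => ?_, ?_⟩
  · dsimp only
    split_ifs with hi
    · have h6 := hx i
      rw [he, hc, ← pow_mul_pow_sub p hi] at h6
      exact Nat.lt_of_mul_lt_mul_left h6
    · positivity
  · rw [← hxy]
    refine Finset.prod_congr rfl fun i _ => ?_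
    dsimp only
    rw [hc i]
    split_ifs with hi
    · rfl
    · have h6 := hx i
      rw [he, hc] at h6
      have h7 : c i = 0 := by
        by_contra h0
        have : p ^ e i ≤ p ^ max s (e i - h) * c i :=
          (Nat.pow_le_pow_right (by omega) (by omega)).trans
            (Nat.le_mul_of_pos_right _ (by omega))
        omega
      rw [h7]

/-- The rank of the subgroup of `p ^ u`-th powers, from the exponents of a basis. -/
def layerRank (e : Fin k → ℕ) (u : ℕ) : ℕ := (Finset.univ.filter fun i => u < e i).card

theorem sum_layerRank (e : Fin k → ℕ) (s h : ℕ) :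
    ∑ u ∈ Finset.Ico s (s + h), layerRank e u = ∑ i, min (e i - s) h := by
  simp only [layerRank, Finset.card_filter]
  rw [Finset.sum_comm]
  refine Finset.sum_congr rfl fun i _ => ?_
  rw [← Finset.card_filter]
  have : (Finset.Ico s (s + h)).filter (· < e i) = Finset.Ico s (min (e i) (s + h)) := by
    ext u; simp only [Finset.mem_filter, Finset.mem_Ico]; omega
  rw [this, Nat.card_Ico]
  omega

/-- The elements that are computed in advance. -/
def precomputed (p : ℕ) (α : Fin k → G) (e : Fin k → ℕ) : Set G :=
  insert 1 {y | ∃ i, ∃ u < e i, ∃ l ≤ Nat.log 2 p, y = α i ^ (p ^ u * 2 ^ l)}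

theorem pow_mem_precomputed {i : Fin k} {u : ℕ} (hu : u < e i) :
    α i ^ p ^ u ∈ precomputed p α e := .inr ⟨i, u, hu, 0, by omega, by simp⟩

theorem gen_precomputed (hp : 2 ≤ p) (he : ∀ i, orderOf (α i) = p ^ e i) (hk : 0 < k) :
    Gen (3 * Nat.log 2 p * ∑ i, e i) (Set.range α) (precomputed p α e) := by
  have h : ∀ i, Gen (3 * Nat.log 2 p * e i) (Set.range α)
      ({y | ∃ u ≤ e i, y = α i ^ p ^ u} ∪
        ⋃ u ∈ Finset.range (e i), {y | ∃ l ≤ Nat.log 2 p, y = (α i ^ p ^ u) ^ 2 ^ l}) := by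
    intro i
    have h1 : Gen _ (Set.range α) {y | ∃ u ≤ e i, y = α i ^ p ^ u} :=
      Gen.iterate_pow (Set.mem_range_self i) (by omega) (e i)
    have h2 := h1.bind (Gen.biUnion (Finset.range (e i)) (fun _ => Nat.log 2 p)
      (fun u => {y | ∃ l ≤ Nat.log 2 p, y = (α i ^ p ^ u) ^ 2 ^ l}) fun u hu =>
        Gen.doublings (.inr ⟨u, (Finset.mem_range.1 hu).le, rfl⟩) (Nat.log 2 p))
    refine h2.mono_cost (le_of_eq ?_)
    simp; ring
  have h3 := Gen.biUnion Finset.univ _ _ fun i _ => h i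
  rw [← Finset.mul_sum] at h3
  refine h3.mono_right ?_
  rintro y (rfl | ⟨i, u, hu, l, hl, rfl⟩)
  · simp only [Set.mem_iUnion]
    exact ⟨⟨0, hk⟩, Finset.mem_univ _, .inl ⟨_, le_rfl, by rw [← he, pow_orderOf_eq_one]⟩⟩
  · simp only [Set.mem_iUnion]
    refine ⟨i, Finset.mem_univ _, .inr ?_⟩
    simp only [Set.mem_iUnion]
    exact ⟨u, Finset.mem_range.2 hu, l, hl, by rw [pow_mul]⟩

/-- An element of a layer agrees, up to an element killed by `p ^ h'`, with one that is cheap to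
compute from the precomputed elements. -/
theorem IsGroupBasis.exists_cheap_approx (hα : IsGroupBasis α) (he : ∀ i, orderOf (α i) = p ^ e i)
    (hp : 2 ≤ p) {s h h' w : ℕ} (hw : 1 ≤ w) (hwh : w ≤ h') {y : G} (hy : y ∈ layer G p s h) :
    ∃ ε ρ : G, y = ε * ρ ∧ (∃ z, ε = z ^ p ^ s) ∧ ρ ^ p ^ h' = 1 ∧
      ∃ q, q * w ≤ 5 * Nat.log 2 p * ∑ u ∈ Finset.Ico s (s + h), layerRank e u ∧
        Gen (q + 2 ^ w) (precomputed p α e) {ε} := by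
  obtain ⟨c, hc, rfl⟩ := hα.exists_coords he hp hy
  set I := Finset.univ.filter fun i => h' < min (e i - s) h with hI
  have hmin : ∀ i, e i - max s (e i - h) = min (e i - s) h := fun i => by omega
  have hq : ∀ i ∈ I, ∃ q, q * w ≤ 5 * Nat.log 2 p * min (e i - s) h ∧
      IsPowProd (precomputed p α e) (2 ^ w) q (α i ^ (p ^ max s (e i - h) * c i)) := by
    intro i hi
    have hi := (Finset.mem_filter.1 hi).2
    rw [pow_mul]
    refine IsPowProd.pow_of_windows hp hw (by omega) (fun v hv l hl => ?_) (hmin i ▸ hc i)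
    rw [← pow_mul, ← mul_assoc, ← pow_add]
    exact .inr ⟨i, _, by have := hmin i; omega, l, hl, rfl⟩
  choose! q hq1 hq2 using hq
  refine ⟨∏ i ∈ I, α i ^ (p ^ max s (e i - h) * c i), ∏ i ∈ Iᶜ, α i ^ (p ^ max s (e i - h) * c i),
    (Finset.prod_mul_prod_compl _ _).symm, ?_, ?_, ∑ i ∈ I, q i, ?_,
    (IsPowProd.prod I q _ hq2).gen (.inl rfl)⟩
  · refine ⟨∏ i ∈ I, α i ^ (p ^ (max s (e i - h) - s) * c i), ?_⟩
    rw [← Finset.prod_pow]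
    refine Finset.prod_congr rfl fun i _ => ?_
    rw [← pow_mul, mul_right_comm, ← pow_add, Nat.sub_add_cancel (le_max_left _ _)]
  · rw [← Finset.prod_pow]
    refine Finset.prod_eq_one fun i hi => ?_
    have hi : min (e i - s) h ≤ h' := by
      simpa only [hI, Finset.mem_compl, Finset.mem_filter, Finset.mem_univ, true_and,
        not_lt] using hi
    rw [← pow_mul, mul_right_comm, ← pow_add, pow_mul]
    have : α i ^ p ^ (max s (e i - h) + h') = 1 := by
      rw [← orderOf_dvd_iff_pow_eq_one, he]
      exact pow_dvd_pow p (by have := hmin i; omega)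
    rw [this, one_pow]
  · rw [sum_layerRank, Finset.sum_mul, Finset.mul_sum]
    exact (Finset.sum_le_sum hq1).trans
      (Finset.sum_le_sum_of_subset (Finset.subset_univ _))

/-- The cost of a discrete logarithm in an elementary abelian group of rank `ρ`. -/
def leafCost (p ρ : ℕ) : ℕ := if ρ = 0 then 0 else 15 * Nat.sqrt (p ^ ρ)

theorem IsGroupBasis.reach_leaf {X : Type*} (hα : IsGroupBasis α)
    (he : ∀ i, orderOf (α i) = p ^ e i) (hp : 2 ≤ p) {s : ℕ} {S : Set X} {K : Set (X → G)}
    (hK : ∀ g ∈ precomputed p α e, (fun _ => g) ∈ K) {f : X → G} (hf : f ∈ K)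
    (hfS : ∀ x ∈ S, f x ∈ layer G p s 1) :
    Reach (fun S' => ∀ x ∈ S', ∀ y ∈ S', f x = f y) (leafCost p (layerRank e s)) S K := by
  classical
  set I := Finset.univ.filter fun i => s < e i with hI
  have hcoord : ∀ x ∈ S, ∃ c : Fin k → ℕ, f x = ∏ i ∈ I, (α i ^ p ^ (e i - 1)) ^ c i := by
    intro x hx
    obtain ⟨c, hc, hfx⟩ := hα.exists_coords he hp (hfS x hx)
    refine ⟨c, hfx.trans ?_⟩
    rw [← Finset.prod_filter_mul_prod_filter_not Finset.univ (fun i => s < e i)]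
    rw [Finset.prod_eq_one (s := Finset.univ.filter fun i => ¬ s < e i), mul_one]
    · refine Finset.prod_congr rfl fun i hi => ?_
      have hi := (Finset.mem_filter.1 hi).2
      rw [← pow_mul, max_eq_right (by omega)]
    · intro i hi
      have hi := (Finset.mem_filter.1 hi).2
      have h1 := hc i
      rw [show e i - max s (e i - 1) = 0 by omega, pow_zero, Nat.lt_one_iff] at h1
      rw [h1]; simp
  have hcard : layerRank e s = I.card := rfl
  rw [hcard]
  unfold leafCost
  split_ifs with h0
  · refine .done fun x hx y hy => ?_
    obtain ⟨c, hc⟩ := hcoord x hx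
    obtain ⟨c', hc'⟩ := hcoord y hy
    rw [Finset.card_eq_zero.1 h0, Finset.prod_empty] at hc hc'
    rw [hc, hc']
  · set γ : I → G := fun i => α i ^ p ^ (e i - 1) with hγdef
    have hγ : ∀ i, γ i ^ p = 1 := by
      rintro ⟨i, hi⟩
      have hi := (Finset.mem_filter.1 hi).2
      rw [hγdef]
      dsimp only
      rw [← pow_mul, ← pow_succ, Nat.sub_add_cancel (by omega), ← he, pow_orderOf_eq_one]
    obtain ⟨A, B, -, hB, hGA, hGB, hAB⟩ := exists_babyGiantSets hp γ hγ I.card Finset.univ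
      (by simp)
    have hgen := (hGA.union hGB).map (N := X → G) ⟨fun g _ => g, fun _ _ => rfl⟩
    have hsub : ∀ g ∈ (insert 1 (γ '' ↑(Finset.univ : Finset I)) : Set G), (fun _ => g) ∈ K := by
      rintro _ (rfl | ⟨⟨i, hi⟩, -, rfl⟩)
      · exact hK _ (.inl rfl)
      · have hi := (Finset.mem_filter.1 hi).2
        exact hK _ (pow_mem_precomputed (show e i - 1 < e i by omega))
    have hgen' := hgen.mono_left (K' := K) (by rintro _ ⟨g, hg, rfl⟩; exact hsub g hg)
    refine (Reach.of_gen (d := B.card) hgen' fun K' hKK' hK' => ?_).mono_cost (by omega)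
    refine Reach.babyStepGiantStep (hKK' hf) A B (fun a ha => hK' ⟨a, .inl ha, rfl⟩)
      (fun b hb => hK' ⟨b, .inr hb, rfl⟩) fun x hx => ?_
    obtain ⟨c, hc⟩ := hcoord x hx
    obtain ⟨a, ha, b, hb, hab⟩ := hAB fun i => c i
    refine ⟨a, ha, b, hb, ?_⟩
    rw [hc, ← hab]
    congr 1
    exact (Finset.prod_coe_sort I fun i => (α i ^ p ^ (e i - 1)) ^ c i).symm

end Basis

section Recursion

/-- The depth of the recursion tree of a node with `2 ^ j` layers, when such a node has
`2 ^ (log₂ j + 1)` children. -/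
def recDepth (j : ℕ) : ℕ := if j = 0 then 0 else recDepth (j - (Nat.log 2 j + 1)) + 1
termination_by j
decreasing_by omega

theorem recDepth_of_ne_zero {j : ℕ} (hj : j ≠ 0) :
    recDepth j = recDepth (j - (Nat.log 2 j + 1)) + 1 := by
  rw [recDepth, if_neg hj]

theorem recDepth_le_of_lt_two_pow {k D : ℕ} (hD : ∀ j < 2 ^ k, recDepth j ≤ D) (q : ℕ) :
    ∀ j, j < 2 ^ k + q * (k + 1) → j < 2 ^ (k + 1) → recDepth j ≤ D + q := by
  induction q with
  | zero => intro j hj _; exact hD j (by omega)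
  | succ q ih =>
    intro j hj hj'
    rcases Nat.lt_or_ge j (2 ^ k) with h | h
    · exact (hD j h).trans (by omega)
    · have hlog : Nat.log 2 j = k := by
        rw [Nat.log_eq_iff (.inr ⟨by norm_num, by have := Nat.two_pow_pos k; omega⟩)]
        exact ⟨h, hj'⟩
      rw [recDepth_of_ne_zero (by have := Nat.two_pow_pos k; omega), hlog]
      have : recDepth (j - (k + 1)) ≤ D + q := by
        refine ih _ ?_ (by omega)
        rw [add_mul, one_mul] at hj
        have := Nat.two_pow_pos k
        omega
      omega

theorem recDepth_le_of_lt (k : ℕ) : ∀ j < 2 ^ k, recDepth j * (k + 1) ≤ 8 * 2 ^ k := by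
  have h2 : ∀ k : ℕ, k + 1 ≤ 2 ^ k := fun k => Nat.lt_two_pow_self
  suffices h : ∀ k, ∃ D, (∀ j < 2 ^ k, recDepth j ≤ D) ∧ D * (k + 1) ≤ 8 * 2 ^ k by
    intro j hj
    obtain ⟨D, hD, hD'⟩ := h k
    exact (Nat.mul_le_mul_right _ (hD j hj)).trans hD'
  intro k
  induction k with
  | zero =>
    refine ⟨0, fun j hj => ?_, by simp⟩
    obtain rfl : j = 0 := by simpa using hj
    rw [recDepth]; simp
  | succ k ih =>
    rcases Nat.eq_zero_or_pos k with rfl | hk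
    · refine ⟨1, fun j hj => ?_, by norm_num⟩
      have h0 : recDepth 0 = 0 := by rw [recDepth]; simp
      rcases Nat.eq_zero_or_pos j with rfl | hj0
      · omega
      · rw [recDepth_of_ne_zero hj0.ne', Nat.sub_eq_zero_of_le (by omega), h0]
    obtain ⟨D, hD, hD'⟩ := ih
    set q := 2 ^ k / (k + 1) + 1 with hq
    have hq1 : 2 ^ k < (k + 1) * q := Nat.lt_mul_div_succ _ (by omega)
    have hq2 : (k + 1) * (2 ^ k / (k + 1)) ≤ 2 ^ k := Nat.mul_div_le _ _
    refine ⟨D + q, fun j hj => recDepth_le_of_lt_two_pow hD q j ?_ hj, ?_⟩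
    · rw [pow_succ] at hj
      nlinarith
    · have h3 : (D + q) * (k + 1) ≤ 10 * 2 ^ k := by
        have := h2 k
        rw [hq]; nlinarith
      have h4 : (D + q) * (k + 1 + 1) * (k + 1) ≤ 8 * 2 ^ (k + 1) * (k + 1) := by
        calc (D + q) * (k + 1 + 1) * (k + 1) = (D + q) * (k + 1) * (k + 2) := by ring
          _ ≤ 10 * 2 ^ k * (k + 2) := Nat.mul_le_mul_right _ h3
          _ ≤ 8 * 2 ^ (k + 1) * (k + 1) := by
              rw [pow_succ]
              have := Nat.two_pow_pos k
              nlinarith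
      exact Nat.le_of_mul_le_mul_right h4 (by omega)

theorem recDepth_le {j : ℕ} (hj : j ≠ 0) : recDepth j ≤ 16 * j / (Nat.log 2 j + 2) := by
  rw [Nat.le_div_iff_mul_le (by omega)]
  have h1 := recDepth_le_of_lt (Nat.log 2 j + 1) j (Nat.lt_pow_succ_log_self (by norm_num) j)
  have h2 : 2 ^ Nat.log 2 j ≤ j := Nat.pow_log_le_self 2 hj
  rw [pow_succ] at h1
  linarith

theorem sq_lt_two_mul_two_pow (j : ℕ) : j ^ 2 < 2 * 2 ^ j := by
  induction j with
  | zero => norm_num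
  | succ j ih =>
    rcases Nat.lt_or_ge j 3 with h | h
    · interval_cases j <;> norm_num
    · rw [pow_succ 2 j]; nlinarith

theorem le_two_pow_sub_div_four (j : ℕ) : j ≤ 2 ^ (j - j / 4) := by
  have h : ∀ q r, r < 4 → 4 * q + r ≤ 2 ^ (3 * q + r) := by
    intro q r hr
    induction q with
    | zero => interval_cases r <;> norm_num
    | succ q ih =>
      rw [show 3 * (q + 1) + r = 3 * q + r + 3 by ring, pow_add]
      have := Nat.two_pow_pos (3 * q + r)
      omega
  have := h (j / 4) (j % 4) (by omega)
  rwa [show 4 * (j / 4) + j % 4 = j by omega,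
    show 3 * (j / 4) + j % 4 = j - j / 4 by omega] at this

variable {X G : Type*} [CommGroup G] {k : ℕ} {α : Fin k → G} {e : Fin k → ℕ} {p : ℕ}

/-- The cost of a node of the recursion tree: `h` layers from layer `s` on. -/
def nodeCost (p : ℕ) (e : Fin k → ℕ) (d s h : ℕ) : ℕ :=
  47 * Nat.log 2 p * d * ∑ u ∈ Finset.Ico s (s + h), (layerRank e u + 1) +
    ∑ u ∈ Finset.Ico s (s + h), leafCost p (layerRank e u)

theorem nodeCost_add (p : ℕ) (e : Fin k → ℕ) (d s h h' : ℕ) :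
    nodeCost p e d s h + nodeCost p e d (s + h) h' = nodeCost p e d s (h + h') := by
  unfold nodeCost
  rw [← add_assoc s, ← Finset.sum_Ico_consecutive _ (show s ≤ s + h by omega)
      (show s + h ≤ s + h + h' by omega),
    ← Finset.sum_Ico_consecutive _ (show s ≤ s + h by omega)
      (show s + h ≤ s + h + h' by omega)]
  ring

/-- The children of a node are treated one after the other, from the last one on. -/
theorem IsGroupBasis.reach_children (hα : IsGroupBasis α) (he : ∀ i, orderOf (α i) = p ^ e i)
    (hp : 2 ≤ p) {d s h h' b w : ℕ} (hh : h = h' * b) (hw : 1 ≤ w) (hwh : w ≤ h')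
    (hchild : ∀ (s' : ℕ) (S : Set X) (K : Set (X → G)) (f : X → G),
      (∀ g ∈ precomputed p α e, (fun _ => g) ∈ K) → f ∈ K → (∀ x ∈ S, f x ∈ layer G p s' h') →
      Reach (fun S' => ∀ x ∈ S', ∀ y ∈ S', f x = f y) (nodeCost p e d s' h') S K)
    {Q : ℕ} (hQ : ∀ q, q * w ≤ 5 * Nat.log 2 p * ∑ u ∈ Finset.Ico s (s + h), layerRank e u → q ≤ Q)
    (t : ℕ) (ht : t ≤ b) (S : Set X) (K : Set (X → G)) (f : X → G)
    (hK : ∀ g ∈ precomputed p α e, (fun _ => g) ∈ K)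
    (hfK : ∀ u < h, f ^ p ^ u ∈ K) (hfS : ∀ x ∈ S, f x ∈ layer G p s h)
    (hft : ∀ x ∈ S, ∀ y ∈ S, f x ^ p ^ (h' * t) = f y ^ p ^ (h' * t)) :
    Reach (fun S' => ∀ x ∈ S', ∀ y ∈ S', f x = f y)
      (t * (Q + 2 ^ w + 1) + nodeCost p e d s (h' * t)) S K := by
  induction t generalizing S K with
  | zero => exact .done (by simpa using hft)
  | succ t ih =>
    rcases S.eq_empty_or_nonempty with rfl | ⟨x₀, hx₀⟩
    · exact .done (by simp)
    have hth : h' * t + h' ≤ h := by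
      rw [hh, ← Nat.mul_succ]; exact Nat.mul_le_mul_left _ ht
    have hh' : 0 < h' := by omega
    obtain ⟨ε, ρ, hερ, ⟨z, hz⟩, hρ, q, hq, hgen⟩ := hα.exists_cheap_approx he hp hw hwh
      (inv_mem_layer (pow_mem_layer (hfS x₀ hx₀) (show h' * t ≤ h by omega)))
    have hqQ : q ≤ Q := by
      refine hQ q (hq.trans (Nat.mul_le_mul_left _ (Finset.sum_le_sum_of_subset ?_)))
      intro u; simp only [Finset.mem_Ico]; omega
    set g : X → G := f ^ p ^ (h' * t) * fun _ => ε with hg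
    have hgS : ∀ x ∈ S, g x ∈ layer G p (s + h' * t) h' := by
      intro x hx
      obtain ⟨⟨y, hy⟩, -⟩ := pow_mem_layer (hfS x hx) (show h' * t ≤ h by omega)
      refine ⟨⟨y * z, ?_⟩, ?_⟩
      · simp only [hg, Pi.mul_apply, Pi.pow_apply]
        rw [hy, hz, mul_pow]
      · have h1 := hft x hx x₀ hx₀
        have h2 : (f x₀ ^ p ^ (h' * t)) ^ p ^ h' * ε ^ p ^ h' = 1 := by
          rw [eq_mul_inv_of_mul_eq hερ.symm, mul_pow, inv_pow, inv_pow, hρ, inv_one, mul_one,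
            mul_inv_cancel]
        simp only [hg, Pi.mul_apply, Pi.pow_apply]
        rw [mul_pow, ← pow_mul (f x), ← pow_add, ← Nat.mul_succ, h1, Nat.mul_succ, pow_add, pow_mul,
          h2]
    have hgen1 := (hgen.map (N := X → G) ⟨fun g _ => g, fun _ _ => rfl⟩).mono_left (K' := K)
      (by rintro _ ⟨g, hg, rfl⟩; exact hK g hg)
    have hgen2 : Gen (q + 2 ^ w + 1) K _ := hgen1.bind (Gen.mul_mem (a := f ^ p ^ (h' * t))
      (b := fun _ => ε) (.inl (hfK _ (by omega))) (.inr ⟨ε, rfl, rfl⟩))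
    have key : Reach (fun S' => ∀ x ∈ S', ∀ y ∈ S', f x = f y)
        ((q + 2 ^ w + 1) + (nodeCost p e d (s + h' * t) h' +
          (t * (Q + 2 ^ w + 1) + nodeCost p e d s (h' * t)))) S K := by
      refine Reach.of_gen hgen2 fun K' hKK' hK' => ?_
      refine (hchild _ S K' g (fun g hg => hKK' (hK g hg)) (hK' (.inr rfl)) hgS).bind
        fun S' K'' hS' hK'' hconst => ?_
      refine ih (by omega) S' K'' (fun g hg => hK'' (hKK' (hK g hg)))
        (fun u hu => hK'' (hKK' (hfK u hu))) (fun x hx => hfS x (hS' hx)) fun x hx y hy => ?_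
      have := hconst x hx y hy
      simpa [hg] using this
    refine key.mono_cost ?_
    rw [Nat.mul_succ h', ← nodeCost_add]
    have : (t + 1) * (Q + 2 ^ w + 1) = t * (Q + 2 ^ w + 1) + (Q + 2 ^ w + 1) := by ring
    omega

theorem IsGroupBasis.reach_node (hα : IsGroupBasis α) (he : ∀ i, orderOf (α i) = p ^ e i)
    (hp : 2 ≤ p) (j s : ℕ) (S : Set X) (K : Set (X → G)) (f : X → G)
    (hK : ∀ g ∈ precomputed p α e, (fun _ => g) ∈ K) (hf : f ∈ K)
    (hfS : ∀ x ∈ S, f x ∈ layer G p s (2 ^ j)) :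
    Reach (fun S' => ∀ x ∈ S', ∀ y ∈ S', f x = f y) (nodeCost p e (recDepth j) s (2 ^ j)) S K := by
  induction j using Nat.strong_induction_on generalizing s S K f with
  | _ j ih =>
  have hL : 1 ≤ Nat.log 2 p := Nat.log_pos (by norm_num) hp
  rcases Nat.eq_zero_or_pos j with rfl | hj
  · exact (hα.reach_leaf he hp hK hf hfS).mono_cost (by simp [nodeCost])
  set a := Nat.log 2 j + 1 with ha
  have haj : a ≤ j := Nat.log_lt_self 2 (by omega)
  have hba : 2 ^ a ≤ 2 * j := by
    rw [ha, pow_succ, mul_comm]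
    exact Nat.mul_le_mul_left _ (Nat.pow_log_le_self 2 (by omega))
  have hja : 2 ^ j = 2 ^ (j - a) * 2 ^ a := by rw [← pow_add, Nat.sub_add_cancel haj]
  set h' := 2 ^ (j - a) with hh'
  set b := 2 ^ a with hb
  set w := j / 4 + 1 with hw
  have hb1 : 1 ≤ b := Nat.one_le_two_pow
  have hwh : w ≤ h' := by
    have h1 := sq_lt_two_mul_two_pow j
    have h2 : h' * b ≤ h' * (2 * j) := Nat.mul_le_mul_left _ hba
    have h3 : j * j < 4 * h' * j := by rw [hja] at h1; nlinarith
    have := Nat.lt_of_mul_lt_mul_right h3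
    omega
  set N := ∑ u ∈ Finset.Ico s (s + 2 ^ j), (layerRank e u + 1) with hN
  set N₀ := ∑ u ∈ Finset.Ico s (s + 2 ^ j), layerRank e u with hN₀
  have hNN : N = N₀ + 2 ^ j := by
    rw [hN, Finset.sum_add_distrib, ← hN₀]; simp
  have hbw : b * 2 ^ w ≤ 4 * 2 ^ j := by
    have h1 := le_two_pow_sub_div_four j
    calc b * 2 ^ w ≤ 2 * j * 2 ^ w := Nat.mul_le_mul_right _ hba
      _ ≤ 2 * 2 ^ (j - j / 4) * 2 ^ w := Nat.mul_le_mul_right _ (Nat.mul_le_mul_left _ h1)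
      _ = 4 * (2 ^ (j - j / 4) * 2 ^ (j / 4)) := by rw [hw, pow_succ]; ring
      _ = 4 * 2 ^ j := by rw [← pow_add, Nat.sub_add_cancel (Nat.div_le_self _ _)]
  have hbh : b ≤ 2 ^ j := Nat.pow_le_pow_right (by norm_num) haj
  set Q := 5 * Nat.log 2 p * N₀ / w with hQ
  have hbQ : b * Q ≤ 40 * Nat.log 2 p * N₀ := by
    have h1 : w * Q ≤ 5 * Nat.log 2 p * N₀ := Nat.mul_div_le _ _
    have h2 : b ≤ 8 * w := by omega
    calc b * Q ≤ 8 * w * Q := Nat.mul_le_mul_right _ h2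
      _ = 8 * (w * Q) := by ring
      _ ≤ 8 * (5 * Nat.log 2 p * N₀) := Nat.mul_le_mul_left _ h1
      _ = _ := by ring
  have hgen : Gen (2 ^ j * (2 * Nat.log 2 p)) K {y | ∃ u ≤ 2 ^ j, y = f ^ p ^ u} :=
    Gen.iterate_pow hf (by omega) (2 ^ j)
  have key : Reach (fun S' => ∀ x ∈ S', ∀ y ∈ S', f x = f y)
      (2 ^ j * (2 * Nat.log 2 p) + (b * (Q + 2 ^ w + 1) +
        nodeCost p e (recDepth (j - a)) s (h' * b))) S K := by
    refine Reach.of_gen hgen fun K' hKK' hK' => ?_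
    refine hα.reach_children he hp (h := 2 ^ j) (d := recDepth (j - a)) hja (by omega) hwh
      (fun s' S K f hK hf hfS => ih (j - a) (by omega) s' S K f hK hf hfS)
      (fun q hq => (Nat.le_div_iff_mul_le (by omega)).2 hq) b le_rfl S K' f
      (fun g hg => hKK' (hK g hg)) (fun u hu => hK' ⟨u, hu.le, rfl⟩) hfS fun x hx y hy => ?_
    rw [← hja, (hfS x hx).2, (hfS y hy).2]
  refine key.mono_cost ?_
  rw [← hja, recDepth_of_ne_zero hj.ne', ← ha]
  unfold nodeCost
  rw [← hN]
  have e1 : b * (Q + 2 ^ w + 1) = b * Q + b * 2 ^ w + b := by ring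
  have e2 : 2 ^ j * (2 * Nat.log 2 p) + (b * Q + b * 2 ^ w + b) ≤ 47 * Nat.log 2 p * N := by
    rw [hNN]
    nlinarith
  rw [e1]
  have e3 : 47 * Nat.log 2 p * (recDepth (j - a) + 1) * N =
    47 * Nat.log 2 p * recDepth (j - a) * N + 47 * Nat.log 2 p * N := by ring
  omega

theorem three_mul_sqrt_two_pow (d : ℕ) : d + 1 ≤ 3 * Nat.sqrt (2 ^ d) := by
  induction d using Nat.twoStepInduction with
  | zero => norm_num
  | one => norm_num
  | more d ih _ =>
    have := Nat.mul_sqrt_le_sqrt_sq_mul 2 (2 ^ d)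
    rw [← pow_add, add_comm 2 d] at this
    omega

theorem mul_sqrt_pow_le (hp : 2 ≤ p) {ρ r : ℕ} (hρ : 0 < ρ) (hr : ρ ≤ r) :
    r * Nat.sqrt (p ^ ρ) ≤ 3 * ρ * Nat.sqrt (p ^ r) := by
  obtain ⟨d, rfl⟩ := Nat.exists_eq_add_of_le hr
  have h1 : Nat.sqrt (p ^ ρ) * Nat.sqrt (2 ^ d) ≤ Nat.sqrt (p ^ (ρ + d)) := by
    rw [Nat.le_sqrt]
    calc _ = (Nat.sqrt (p ^ ρ) * Nat.sqrt (p ^ ρ)) * (Nat.sqrt (2 ^ d) * Nat.sqrt (2 ^ d)) := by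
            ring
      _ ≤ p ^ ρ * 2 ^ d := Nat.mul_le_mul (Nat.sqrt_le _) (Nat.sqrt_le _)
      _ ≤ p ^ ρ * p ^ d := Nat.mul_le_mul_left _ (Nat.pow_le_pow_left hp d)
      _ = _ := (pow_add _ _ _).symm
  have h2 := three_mul_sqrt_two_pow d
  have h3 : ρ + d ≤ ρ * (d + 1) := by nlinarith
  calc (ρ + d) * Nat.sqrt (p ^ ρ) ≤ ρ * (3 * Nat.sqrt (2 ^ d)) * Nat.sqrt (p ^ ρ) :=
        Nat.mul_le_mul_right _ (h3.trans (Nat.mul_le_mul_left _ h2))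
    _ = 3 * ρ * (Nat.sqrt (p ^ ρ) * Nat.sqrt (2 ^ d)) := by ring
    _ ≤ _ := Nat.mul_le_mul_left _ h1

/-- The number of multiplications allowed for exponents of sum `n`, maximum `m`, and `r` nonzero
entries. -/
def costBound (p n m r : ℕ) : ℕ :=
  144 * Nat.log 2 p * (16 * (Nat.log 2 m + 1) / (Nat.log 2 (Nat.log 2 m + 1) + 2)) * n +
    45 * n * Nat.sqrt (p ^ r) / r

theorem IsGroupBasis.reach (hα : IsGroupBasis α) (he : ∀ i, orderOf (α i) = p ^ e i)
    (hp : 2 ≤ p) {m : ℕ} (hm : ∀ i, e i ≤ m) (hm' : m ≤ ∑ i, e i) :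
    Reach (X := G) (G := G) Set.Subsingleton (costBound p (∑ i, e i) m (layerRank e 0)) Set.univ
      (insert id (Set.range fun i _ => α i)) := by
  rcases Nat.eq_zero_or_pos m with rfl | hm0
  · refine .done fun x _ y _ => ?_
    obtain ⟨c, ⟨-, rfl⟩, -⟩ := hα x
    obtain ⟨c', ⟨-, rfl⟩, -⟩ := hα y
    rw [hα.prod_pow_eq_iff]
    intro i
    rw [he, Nat.le_zero.1 (hm i), pow_zero]
    exact Nat.modEq_one
  have hL : 1 ≤ Nat.log 2 p := Nat.log_pos (by norm_num) hp
  have hk : 0 < k := by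
    rcases Nat.eq_zero_or_pos k with rfl | h
    · simp at hm'; omega
    · exact h
  set n := ∑ i, e i with hn
  set J := Nat.log 2 m + 1 with hJ
  have hJm : m < 2 ^ J := Nat.lt_pow_succ_log_self (by norm_num) m
  have hJm' : 2 ^ J ≤ 2 * m := by
    rw [hJ, pow_succ, mul_comm]
    exact Nat.mul_le_mul_left _ (Nat.pow_log_le_self 2 (by omega))
  have hgen := ((gen_precomputed hp he hk).map (N := G → G) ⟨fun g _ => g, fun _ _ => rfl⟩).mono_left
    (K' := insert id (Set.range fun i _ => α i)) (by
      rintro _ ⟨_, ⟨i, rfl⟩, rfl⟩; exact .inr ⟨i, rfl⟩)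
  have key := Reach.of_gen (S := Set.univ) (Q := Set.Subsingleton)
    (d := nodeCost p e (recDepth J) 0 (2 ^ J) + 0) hgen fun K' hKK' hK' => by
    refine (hα.reach_node he hp J 0 Set.univ K' id (fun g hg => hK' ⟨g, hg, rfl⟩)
      (hKK' (.inl rfl)) fun x _ => ⟨⟨x, by simp⟩, ?_⟩).bind fun S' K'' _ _ hQ =>
        .done fun x hx y hy => hQ x hx y hy
    obtain ⟨c, ⟨-, rfl⟩, -⟩ := hα x
    simp only [id]
    rw [← Finset.prod_pow]
    refine Finset.prod_eq_one fun i _ => ?_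
    rw [← pow_mul, ← orderOf_dvd_iff_pow_eq_one, he]
    exact Dvd.dvd.mul_left (pow_dvd_pow p ((hm i).trans hJm.le)) _
  refine key.mono_cost ?_
  have hsum : ∑ u ∈ Finset.Ico 0 (0 + 2 ^ J), layerRank e u = n := by
    rw [sum_layerRank, hn]
    exact Finset.sum_congr rfl fun i _ => by have := hm i; omega
  have h1 : ∑ u ∈ Finset.Ico 0 (0 + 2 ^ J), (layerRank e u + 1) ≤ 3 * n := by
    rw [Finset.sum_add_distrib, hsum]
    simp; omega
  have hr0 : 0 < layerRank e 0 := by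
    rw [layerRank, Finset.card_pos]
    by_contra h
    rw [Finset.not_nonempty_iff_eq_empty, Finset.filter_eq_empty_iff] at h
    have : n = 0 := Finset.sum_eq_zero fun i hi => by have := h hi; omega
    omega
  have h2 : ∑ u ∈ Finset.Ico 0 (0 + 2 ^ J), leafCost p (layerRank e u) ≤
      45 * n * Nat.sqrt (p ^ layerRank e 0) / layerRank e 0 := by
    rw [Nat.le_div_iff_mul_le hr0, ← hsum, Finset.sum_mul, Finset.mul_sum, Finset.sum_mul]
    refine Finset.sum_le_sum fun u _ => ?_
    have hle : layerRank e u ≤ layerRank e 0 := Finset.card_le_card fun i => by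
      simp only [Finset.mem_filter, Finset.mem_univ, true_and]; omega
    unfold leafCost
    split_ifs with h0
    · simp
    · have := mul_sqrt_pow_le hp (Nat.pos_of_ne_zero h0) hle
      linarith
  have h3 := recDepth_le (j := J) (by omega)
  have h4 : 1 ≤ 16 * J / (Nat.log 2 J + 2) := by
    rw [Nat.le_div_iff_mul_le (by omega)]
    have := Nat.log_lt_self 2 (x := J) (by omega)
    omega
  set D := 16 * J / (Nat.log 2 J + 2)
  have h5 : 47 * Nat.log 2 p * recDepth J * ∑ u ∈ Finset.Ico 0 (0 + 2 ^ J), (layerRank e u + 1) ≤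
      47 * Nat.log 2 p * D * (3 * n) :=
    Nat.mul_le_mul (Nat.mul_le_mul_left _ h3) h1
  have h6 : 3 * Nat.log 2 p * n ≤ 3 * Nat.log 2 p * D * n :=
    Nat.mul_le_mul_right _ (Nat.le_mul_of_pos_right _ h4)
  unfold costBound nodeCost
  have e1 : 144 * Nat.log 2 p * D * n =
      47 * Nat.log 2 p * D * (3 * n) + 3 * Nat.log 2 p * D * n := by ring
  rw [e1, ← hn]
  omega

end Recursion

section Simulation

/-- Addition of exponent vectors modulo the orders `p ^ e_i`; here `a = (p, e)`. -/
def expAdd (a : ℕ × List ℕ) (v w : List ℕ) : List ℕ :=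
  (List.range a.2.length).map fun i => (v.getD i 0 + w.getD i 0) % a.1 ^ a.2.getD i 0

/-- The exponent vector of the basis element with index `i`. -/
def expUnit (a : ℕ × List ℕ) (i : ℕ) : List ℕ :=
  (List.range a.2.length).map fun j => (if j = i then 1 else 0) % a.1 ^ a.2.getD j 0

/-- The exponent vectors of the basis and of the given element. -/
def simStart (a : ℕ × List ℕ) (v : List ℕ) : List (List ℕ) :=
  (List.range a.2.length).map (expUnit a) ++ [v]

/-- One move of the strategy given by the table `τ`, on exponent vectors. -/
def simStep (τ : List (List ℕ × Move)) (a : ℕ × List ℕ) (L : List (List ℕ)) : List (List ℕ) :=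
  Sum.casesOn (tableMove τ (pattern L))
    (fun q => if q.1 < L.length ∧ q.2 < L.length then
      L ++ [expAdd a (L.getD q.1 []) (L.getD q.2 [])] else L)
    (fun _ => L)

/-- All reduced exponent vectors. -/
def allVectors (a : ℕ × List ℕ) : List (List ℕ) :=
  a.2.foldr (fun b acc => (List.range (a.1 ^ b)).flatMap fun x => acc.map fun v => x :: v) [[]]

/-- The cost bound as a function of the input. -/
def inputBound (a : ℕ × List ℕ) : ℕ :=
  costBound a.1 (a.2.foldr (· + ·) 0) (a.2.foldr max 0) (a.2.filter fun b => 0 < b).length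

/-- The table `τ` yields every discrete logarithm within the cost bound. -/
def TableWorks (a : ℕ × List ℕ) (τ : List (List ℕ × Move)) : Prop :=
  ∀ v ∈ allVectors a,
    tableMove τ (pattern ((simStep τ a)^[inputBound a] (simStart a v))) = .inr v

theorem simStep_inl {τ : List (List ℕ × Move)} {a : ℕ × List ℕ} {L : List (List ℕ)} {q : ℕ × ℕ}
    (h : tableMove τ (pattern L) = .inl q) : simStep τ a L =
      if q.1 < L.length ∧ q.2 < L.length then
        L ++ [expAdd a (L.getD q.1 []) (L.getD q.2 [])] else L := by
  rw [simStep, h]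

theorem simStep_inr {τ : List (List ℕ × Move)} {a : ℕ × List ℕ} {L : List (List ℕ)} {x : List ℕ}
    (h : tableMove τ (pattern L) = .inr x) : simStep τ a L = L := by
  rw [simStep, h]

variable {k : ℕ} {p : ℕ} {e : Fin k → ℕ}

theorem getD_ofFn {T : Type*} (x : Fin k → T) (d : T) (i : Fin k) :
    (List.ofFn x).getD i d = x i := by
  simp [List.getD_eq_getElem?_getD]

theorem map_range_length_ofFn {T : Type*} (f : ℕ → T) :
    (List.range (List.ofFn e).length).map f = List.ofFn fun i : Fin k => f i := by
  apply List.ext_getElem <;> simp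

theorem expAdd_ofFn (x y : Fin k → ℕ) :
    expAdd (p, List.ofFn e) (List.ofFn x) (List.ofFn y) =
      List.ofFn fun i => (x i + y i) % p ^ e i := by
  rw [expAdd, map_range_length_ofFn]
  simp only [getD_ofFn]

theorem mem_allVectors {a : ℕ × List ℕ} {v : List ℕ} :
    v ∈ allVectors a ↔ List.Forall₂ (fun x b => x < a.1 ^ b) v a.2 := by
  obtain ⟨p, e⟩ := a
  unfold allVectors
  induction e generalizing v with
  | nil => simp
  | cons b e ih =>
    simp only [List.foldr_cons, List.mem_flatMap, List.mem_range, List.mem_map]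
    dsimp only at ih
    simp only [ih]
    rw [List.forall₂_cons_right_iff]
    grind

theorem mem_allVectors_ofFn {v : List ℕ} : v ∈ allVectors (p, List.ofFn e) ↔
    ∃ x : Fin k → ℕ, (∀ i, x i < p ^ e i) ∧ v = List.ofFn x := by
  rw [mem_allVectors, List.forall₂_iff_get]
  constructor
  · rintro ⟨h1, h2⟩
    have hlen : v.length = k := by simpa using h1
    subst hlen
    exact ⟨v.get, fun i => by simpa using h2 i i.2 (by simp), by simp⟩
  · rintro ⟨x, hx, rfl⟩
    exact ⟨by simp, fun i h1 h2 => by simpa using hx ⟨i, by simpa using h1⟩⟩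

variable {G : Type*} [CommGroup G] {α : Fin k → G}

/-- The group element with a given exponent vector. -/
def evalVec (α : Fin k → G) (v : List ℕ) : G := ∏ i, α i ^ v.getD i 0

theorem evalVec_ofFn (x : Fin k → ℕ) : evalVec α (List.ofFn x) = ∏ i, α i ^ x i := by
  simp only [evalVec, getD_ofFn]

theorem IsGroupBasis.injOn_evalVec (hα : IsGroupBasis α) (he : ∀ i, orderOf (α i) = p ^ e i) :
    Set.InjOn (evalVec α) {v | v ∈ allVectors (p, List.ofFn e)} := by
  intro v hv w hw h
  obtain ⟨x, hx, rfl⟩ := mem_allVectors_ofFn.1 hv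
  obtain ⟨y, hy, rfl⟩ := mem_allVectors_ofFn.1 hw
  rw [evalVec_ofFn, evalVec_ofFn] at h
  exact congrArg _ ((hα _).unique ⟨fun i => he i ▸ hx i, h⟩ ⟨fun i => he i ▸ hy i, rfl⟩)

theorem expAdd_mem (hp : 0 < p) (v w : List ℕ) :
    expAdd (p, List.ofFn e) v w ∈ allVectors (p, List.ofFn e) := by
  rw [expAdd, map_range_length_ofFn]
  exact mem_allVectors_ofFn.2 ⟨_, fun i => by
    rw [getD_ofFn]; exact Nat.mod_lt _ (by positivity), rfl⟩

theorem evalVec_expAdd (he : ∀ i, orderOf (α i) = p ^ e i) {v w : List ℕ}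
    (hv : v ∈ allVectors (p, List.ofFn e)) (hw : w ∈ allVectors (p, List.ofFn e)) :
    evalVec α (expAdd (p, List.ofFn e) v w) = evalVec α v * evalVec α w := by
  obtain ⟨x, hx, rfl⟩ := mem_allVectors_ofFn.1 hv
  obtain ⟨y, hy, rfl⟩ := mem_allVectors_ofFn.1 hw
  rw [expAdd_ofFn, evalVec_ofFn, evalVec_ofFn, evalVec_ofFn, ← Finset.prod_mul_distrib]
  refine Finset.prod_congr rfl fun i _ => ?_
  rw [← he, pow_mod_orderOf, pow_add]

theorem expUnit_mem (hp : 0 < p) (i : ℕ) :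
    expUnit (p, List.ofFn e) i ∈ allVectors (p, List.ofFn e) := by
  rw [expUnit, map_range_length_ofFn]
  exact mem_allVectors_ofFn.2 ⟨_, fun i => by
    rw [getD_ofFn]; exact Nat.mod_lt _ (by positivity), rfl⟩

theorem evalVec_expUnit (he : ∀ i, orderOf (α i) = p ^ e i) (i : Fin k) :
    evalVec α (expUnit (p, List.ofFn e) i) = α i := by
  rw [expUnit, map_range_length_ofFn, evalVec_ofFn]
  simp only [getD_ofFn, ← he, pow_mod_orderOf]
  rw [Finset.prod_eq_single i (fun j _ hj => by rw [if_neg (by simpa [Fin.ext_iff] using hj),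
    pow_zero]) (by simp)]
  simp

theorem simStart_mem (hp : 0 < p) {v : List ℕ} (hv : v ∈ allVectors (p, List.ofFn e)) :
    ∀ w ∈ simStart (p, List.ofFn e) v, w ∈ allVectors (p, List.ofFn e) := by
  intro w hw
  simp only [simStart, List.mem_append, List.mem_map, List.mem_singleton] at hw
  rcases hw with ⟨i, -, rfl⟩ | rfl
  exacts [expUnit_mem hp i, hv]

theorem map_simStart (he : ∀ i, orderOf (α i) = p ^ e i) (v : List ℕ) :
    (simStart (p, List.ofFn e) v).map (evalVec α) = List.ofFn α ++ [evalVec α v] := by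
  rw [simStart, map_range_length_ofFn, List.map_append, List.map_ofFn]
  congr 2
  funext i
  exact evalVec_expUnit he i

theorem map_concat_expAdd (he : ∀ i, orderOf (α i) = p ^ e i) {L : List (List ℕ)}
    (hL : ∀ w ∈ L, w ∈ allVectors (p, List.ofFn e)) {i j : ℕ} (hi : i < L.length)
    (hj : j < L.length) :
    (L ++ [expAdd (p, List.ofFn e) (L.getD i []) (L.getD j [])]).map (evalVec α) =
      L.map (evalVec α) ++ [evalVec α L[i] * evalVec α L[j]] := by
  rw [List.getD_eq_getElem _ _ hi, List.getD_eq_getElem _ _ hj, List.map_append, List.map_singleton,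
    evalVec_expAdd he (hL _ (List.getElem_mem hi)) (hL _ (List.getElem_mem hj))]

theorem Runs.simulate (hα : IsGroupBasis α) (he : ∀ i, orderOf (α i) = p ^ e i) (hp : 0 < p)
    {τ : List (List ℕ × Move)} {t : ℕ} {L : List G} {x : List ℕ} (h : Runs (tableMove τ) t L x) :
    ∀ Lv : List (List ℕ), (∀ w ∈ Lv, w ∈ allVectors (p, List.ofFn e)) → L = Lv.map (evalVec α) →
      tableMove τ (pattern ((simStep τ (p, List.ofFn e))^[t] Lv)) = .inr x := by
  classical
  have hpat : ∀ Lv : List (List ℕ), (∀ w ∈ Lv, w ∈ allVectors (p, List.ofFn e)) →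
      pattern (Lv.map (evalVec α)) = pattern Lv := fun Lv hLv =>
    pattern_map _ _ ((hα.injOn_evalVec he).mono hLv)
  induction h with
  | @out t L x h =>
    rintro Lv hLv rfl
    have h : tableMove τ (pattern Lv) = .inr x := by rw [← h, ← hpat Lv hLv]
    rw [Function.iterate_fixed (simStep_inr h), h]
  | @mul t L x i j g g' h hi hj _ ih =>
    rintro Lv hLv rfl
    have h : tableMove τ (pattern Lv) = .inl (i, j) := by rw [← h, ← hpat Lv hLv]
    obtain ⟨hi1, hi2⟩ := List.getElem?_eq_some_iff.1 hi
    obtain ⟨hj1, hj2⟩ := List.getElem?_eq_some_iff.1 hj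
    rw [List.length_map] at hi1 hj1
    rw [List.getElem_map] at hi2 hj2
    rw [Function.iterate_succ_apply, simStep_inl h, if_pos ⟨hi1, hj1⟩]
    refine ih _ (fun w hw => ?_) ?_
    · rcases List.mem_append.1 hw with hw | hw
      · exact hLv w hw
      · rw [List.mem_singleton.1 hw]; exact expAdd_mem hp _ _
    · rw [map_concat_expAdd he hLv hi1 hj1, hi2, hj2]

/-- A move as an action of a generic algorithm. -/
def Move.toAction (m : Move) : GenericAction (List ℕ) :=
  (GenericAction.equivSum (List ℕ)).symm (Sum.casesOn m (fun q => .inl (.inr q)) fun x => .inr (.inr x))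

theorem computes_of_simulation (hα : IsGroupBasis α) (he : ∀ i, orderOf (α i) = p ^ e i)
    (hp : 0 < p) {τ : List (List ℕ × Move)} {A : GenericAlgorithm (ℕ × List ℕ) (List ℕ)}
    (hA : ∀ ids, A.next ((p, List.ofFn e), ids) = (tableMove τ (pattern ids)).toAction)
    {ν : G → ℕ} (hν : Function.Injective ν) {x : List ℕ} (t : ℕ) :
    ∀ Lv : List (List ℕ), (∀ w ∈ Lv, w ∈ allVectors (p, List.ofFn e)) →
      tableMove τ (pattern ((simStep τ (p, List.ofFn e))^[t] Lv)) = .inr x →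
      ∃ t' ≤ t, A.Computes (p, List.ofFn e) ν (Lv.map (evalVec α)) t' x := by
  classical
  have hpat : ∀ Lv : List (List ℕ), (∀ w ∈ Lv, w ∈ allVectors (p, List.ofFn e)) →
      A.next ((p, List.ofFn e), (Lv.map (evalVec α)).map ν) =
        (tableMove τ (pattern Lv)).toAction := fun Lv hLv => by
    rw [hA, pattern_map _ _ hν.injOn, pattern_map _ _ ((hα.injOn_evalVec he).mono hLv)]
  induction t with
  | zero =>
    intro Lv hLv h
    refine ⟨0, le_rfl, .output ?_⟩
    rw [hpat Lv hLv, show tableMove τ (pattern Lv) = .inr x from h]; rfl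
  | succ t ih =>
    intro Lv hLv h
    rcases hm : tableMove τ (pattern Lv) with ⟨i, j⟩ | y
    · by_cases hij : i < Lv.length ∧ j < Lv.length
      · rw [Function.iterate_succ_apply, simStep_inl hm, if_pos hij] at h
        obtain ⟨t', ht', hc⟩ := ih _ (fun w hw => by
          rcases List.mem_append.1 hw with hw | hw
          · exact hLv w hw
          · rw [List.mem_singleton.1 hw]; exact expAdd_mem hp _ _) h
        rw [map_concat_expAdd he hLv hij.1 hij.2] at hc
        refine ⟨t' + 1, by omega, .mul (i := i) (j := j) ?_ ?_ ?_ hc⟩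
        · rw [hpat Lv hLv, hm]; rfl
        · rw [List.getElem?_map, List.getElem?_eq_getElem hij.1]; rfl
        · rw [List.getElem?_map, List.getElem?_eq_getElem hij.2]; rfl
      · have hfix : simStep τ (p, List.ofFn e) Lv = Lv := by rw [simStep_inl hm, if_neg hij]
        rw [Function.iterate_fixed hfix, hm] at h
        exact absurd h (by simp)
    · rw [Function.iterate_fixed (simStep_inr hm), hm] at h
      refine ⟨0, by omega, .output ?_⟩
      rw [hpat Lv hLv, hm, h]; rfl

theorem foldr_add_ofFn (e : Fin k → ℕ) : (List.ofFn e).foldr (· + ·) 0 = ∑ i, e i := by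
  rw [← List.sum_ofFn]; rfl

theorem le_foldr_max {l : List ℕ} {b : ℕ} (hb : b ∈ l) : b ≤ l.foldr max 0 := by
  induction l with
  | nil => simp at hb
  | cons c l ih =>
    rw [List.foldr_cons]
    rcases List.mem_cons.1 hb with rfl | hb
    · exact le_max_left _ _
    · exact (ih hb).trans (le_max_right _ _)

theorem foldr_max_le {l : List ℕ} {m : ℕ} (h : ∀ b ∈ l, b ≤ m) : l.foldr max 0 ≤ m := by
  induction l with
  | nil => simp
  | cons c l ih => exact max_le (h c (by simp)) (ih fun b hb => h b (by simp [hb]))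

theorem length_filter_ofFn (e : Fin k → ℕ) :
    ((List.ofFn e).filter fun b => 0 < b).length = layerRank e 0 := by
  rw [layerRank, ← List.countP_eq_length_filter]
  induction k with
  | zero => simp
  | succ k ih =>
    rw [List.ofFn_succ, List.countP_cons, ih, Fin.univ_succ, Finset.filter_cons]
    by_cases h : 0 < e 0
    · rw [if_pos h, Finset.card_cons, Finset.filter_map, Finset.card_map]
      simp [h]
    · rw [if_neg h, Finset.filter_map, Finset.card_map]
      simp [h]

theorem inputBound_ofFn (p : ℕ) (e : Fin k → ℕ) : inputBound (p, List.ofFn e) =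
    costBound p (∑ i, e i) ((List.ofFn e).foldr max 0) (layerRank e 0) := by
  rw [inputBound, foldr_add_ofFn, length_filter_ofFn]

theorem IsGroupBasis.exists_tableWorks [Finite G] (hα : IsGroupBasis α)
    (he : ∀ i, orderOf (α i) = p ^ e i) (hp : 2 ≤ p) :
    ∃ τ, TableWorks (p, List.ofFn e) τ := by
  choose x hx using fun β => (hα β).exists
  have h1 := hα.reach he hp (m := (List.ofFn e).foldr max 0)
    (fun i => le_foldr_max (by simp)) (foldr_max_le fun b hb => by
      obtain ⟨i, rfl⟩ := (List.mem_ofFn' e b).1 hb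
      exact Finset.single_le_sum (fun _ _ => Nat.zero_le _) (Finset.mem_univ i))
  obtain ⟨F, hF⟩ := h1.exists_strategy (fun β => List.ofFn (x β))
    (List.ofFn (fun i _ => α i) ++ [id]) (by
      rintro f (rfl | ⟨i, rfl⟩) <;> simp)
  obtain ⟨τ, hτ⟩ := exists_table fun β => hF β (Set.mem_univ β)
  refine ⟨τ, fun v hv => ?_⟩
  obtain ⟨y, hy, rfl⟩ := mem_allVectors_ofFn.1 hv
  have hxy : x (∏ i, α i ^ y i) = y :=
    (hα _).unique (hx _) ⟨fun i => he i ▸ hy i, rfl⟩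
  rw [inputBound_ofFn]
  have h2 := hτ (∏ i, α i ^ y i)
  rw [hxy] at h2
  refine h2.simulate hα he (by omega) _ (simStart_mem (by omega) hv) ?_
  rw [map_simStart he, evalVec_ofFn, List.map_append, List.map_ofFn]
  rfl

end Simulation

section Computability

open Primrec

theorem primrec_pow : Primrec₂ ((· ^ ·) : ℕ → ℕ → ℕ) := Primrec₂.unpaired'.1 Nat.Primrec.pow

theorem log_two_eq_findGreatest (n : ℕ) :
    Nat.log 2 n = Nat.findGreatest (fun k => 2 ^ k ≤ n) n := by
  rcases Nat.eq_zero_or_pos n with rfl | hn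
  · simp
  · refine le_antisymm (Nat.le_findGreatest (Nat.log_le_self _ _) (Nat.pow_log_le_self 2 hn.ne')) ?_
    have := Nat.findGreatest_spec (P := fun k => 2 ^ k ≤ n) (m := 0) (n := n) (Nat.zero_le _) hn
    exact Nat.le_log_of_pow_le (by norm_num) this

theorem primrec_log_two : Primrec (Nat.log 2) :=
  (nat_findGreatest (p := fun n k => 2 ^ k ≤ n) Primrec.id
    (nat_le.comp (primrec_pow.comp (.const 2) snd) fst)).of_eq
    fun n => (log_two_eq_findGreatest n).symm

theorem primrec_inputBound : Primrec inputBound := by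
  have hsum : Primrec fun a : ℕ × List ℕ => a.2.foldr (· + ·) 0 :=
    list_foldr snd (.const 0) (nat_add.comp (fst.comp snd) (snd.comp snd)).to₂
  have hmax : Primrec fun a : ℕ × List ℕ => a.2.foldr max 0 :=
    list_foldr snd (.const 0) (nat_max.comp (fst.comp snd) (snd.comp snd)).to₂
  have hlen : Primrec fun a : ℕ × List ℕ => (a.2.filter fun b => 0 < b).length :=
    list_length.comp ((listFilter (nat_lt.comp (.const 0) .id)).comp snd)
  have hlog : Primrec fun a : ℕ × List ℕ => Nat.log 2 (a.2.foldr max 0) + 1 :=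
    succ.comp (primrec_log_two.comp hmax)
  have hD := nat_div.comp (nat_mul.comp (.const 16) hlog)
    (nat_add.comp (primrec_log_two.comp hlog) (.const 2))
  have h1 := nat_mul.comp (nat_mul.comp (nat_mul.comp (.const 144) (primrec_log_two.comp fst)) hD)
    hsum
  have h2 := nat_div.comp (nat_mul.comp (nat_mul.comp (.const 45) hsum)
    (Primrec.nat_sqrt.comp (primrec_pow.comp fst hlen))) hlen
  exact nat_add.comp h1 h2

theorem primrec_pattern {T : Type*} [Primcodable T] [DecidableEq T] :
    Primrec (pattern : List T → List ℕ) :=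
  list_map .id (list_idxOf.comp snd fst)

theorem primrec_tableMove : Primrec₂ tableMove :=
  (option_getD.comp (listLookup.comp snd fst) (.const (.inr []))).of_eq fun x => by
    unfold tableMove; congr!

theorem primrec_expAdd :
    Primrec fun x : (ℕ × List ℕ) × List ℕ × List ℕ => expAdd x.1 x.2.1 x.2.2 := by
  refine list_map (list_range.comp (list_length.comp (snd.comp fst))) ?_
  refine nat_mod.comp (nat_add.comp ?_ ?_) (primrec_pow.comp (fst.comp (fst.comp fst)) ?_)
  · exact (list_getD 0).comp (fst.comp (snd.comp fst)) snd
  · exact (list_getD 0).comp (snd.comp (snd.comp fst)) snd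
  · exact (list_getD 0).comp (snd.comp (fst.comp fst)) snd

theorem primrec_expUnit : Primrec₂ expUnit := by
  refine list_map (list_range.comp (list_length.comp (snd.comp fst))) ?_
  refine nat_mod.comp (Primrec.ite (Primrec.eq.comp snd (snd.comp fst)) (.const 1) (.const 0))
    (primrec_pow.comp (fst.comp (fst.comp fst)) ?_)
  exact (list_getD 0).comp (snd.comp (fst.comp fst)) snd

theorem primrec_simStart : Primrec₂ simStart := by
  refine list_append.comp (list_map (list_range.comp (list_length.comp (snd.comp fst))) ?_)
    (list_cons.comp snd (.const []))
  exact primrec_expUnit.comp (fst.comp fst) snd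

theorem primrec_simStep : Primrec
    fun x : (List (List ℕ × Move) × (ℕ × List ℕ)) × List (List ℕ) => simStep x.1.1 x.1.2 x.2 := by
  refine sumCasesOn (primrec_tableMove.comp (fst.comp fst) (primrec_pattern.comp snd)) ?_
    (snd.comp fst)
  refine Primrec.ite (PrimrecPred.and ?_ ?_) (list_append.comp (snd.comp fst)
    (list_cons.comp (primrec_expAdd.comp (.pair (snd.comp (fst.comp fst)) (.pair ?_ ?_)))
      (.const []))) (snd.comp fst)
  · exact nat_lt.comp (fst.comp snd) (list_length.comp (snd.comp fst))
  · exact nat_lt.comp (snd.comp snd) (list_length.comp (snd.comp fst))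
  · exact (list_getD []).comp (snd.comp fst) (fst.comp snd)
  · exact (list_getD []).comp (snd.comp fst) (snd.comp snd)

theorem primrec_allVectors : Primrec allVectors := by
  have h : Primrec₂ fun (a : ℕ × List ℕ) (q : ℕ × List (List ℕ)) =>
      (List.range (a.1 ^ q.1)).flatMap fun x => q.2.map fun v => x :: v := by
    refine list_flatMap (list_range.comp (primrec_pow.comp (fst.comp fst) (fst.comp snd))) ?_
    exact list_map (snd.comp (snd.comp fst)) (list_cons.comp (snd.comp fst) snd)
  exact list_foldr snd (.const [[]]) h

theorem primrecPred_tableWorks : PrimrecPred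
    fun x : (ℕ × List ℕ) × List (List ℕ × Move) => TableWorks x.1 x.2 := by
  have h : PrimrecRel fun (v : List ℕ) (x : (ℕ × List ℕ) × List (List ℕ × Move)) =>
      tableMove x.2 (pattern ((simStep x.2 x.1)^[inputBound x.1] (simStart x.1 v))) = .inr v := by
    refine Primrec.eq.comp (primrec_tableMove.comp (snd.comp snd) (primrec_pattern.comp ?_))
      (sumInr.comp fst)
    refine nat_iterate (primrec_inputBound.comp (fst.comp snd))
      (primrec_simStart.comp (fst.comp snd) fst) ?_
    exact primrec_simStep.comp (.pair (.pair (snd.comp (snd.comp fst)) (fst.comp (snd.comp fst)))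
      snd)
  exact h.forall_mem_list.comp (primrec_allVectors.comp fst) .id

/-- The table with code `n` can be used for the input `a`. -/
def GoodCode (a : ℕ × List ℕ) (n : ℕ) : Prop :=
  a.1 < 2 ∨ TableWorks a ((Encodable.decode (α := List (List ℕ × Move)) n).getD [])

theorem primrecRel_goodCode : PrimrecRel GoodCode :=
  PrimrecPred.or (nat_lt.comp (fst.comp fst) (.const 2))
    (primrecPred_tableWorks.comp (.pair fst (option_getD.comp (Primrec.decode.comp snd) (.const []))))

open Classical in
theorem computable_find {P : (ℕ × List ℕ) → ℕ → Prop} (hP : PrimrecRel P)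
    (h : ∀ a, ∃ n, P a n) : Computable fun a => Nat.find (h a) := by
  have h1 : Partrec fun a => Nat.rfind fun n => Part.some (decide (P a n)) :=
    Partrec.rfind (hP.decide.to_comp.partrec)
  refine h1.of_eq_tot fun a => ?_
  refine Nat.mem_rfind.2 ⟨?_, fun hm => ?_⟩
  · simpa using Nat.find_spec (h a)
  · simpa using Nat.find_min (h a) hm

theorem primrec_toAction : Primrec Move.toAction :=
  Primrec.of_equiv_symm.comp
    (sumCasesOn .id (sumInl.comp (sumInr.comp snd)) (sumInr.comp (sumInr.comp snd)))

end Computability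

section Search

/-- A model of the group with basis of orders `p ^ e_i`. -/
theorem isGroupBasis_mulSingle {k : ℕ} (q : Fin k → ℕ) (hq : ∀ i, 0 < q i) :
    IsGroupBasis (G := ∀ i, Multiplicative (ZMod (q i)))
      (fun i => Pi.mulSingle i (Multiplicative.ofAdd 1)) ∧
    ∀ i, orderOf (Pi.mulSingle (M := fun i => Multiplicative (ZMod (q i))) i
      (Multiplicative.ofAdd 1)) = q i := by
  have hord : ∀ i, orderOf (Pi.mulSingle (M := fun i => Multiplicative (ZMod (q i))) i
      (Multiplicative.ofAdd 1)) = q i := fun i => by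
    rw [orderOf_piMulSingle, orderOf_ofAdd_eq_addOrderOf, ZMod.addOrderOf_one]
  have hprod : ∀ x : Fin k → ℕ, (∏ i, (Pi.mulSingle (M := fun i => Multiplicative (ZMod (q i))) i
      (Multiplicative.ofAdd 1)) ^ x i) = fun i => Multiplicative.ofAdd (x i : ZMod (q i)) := by
    intro x
    simp only [← Pi.mulSingle_pow]
    rw [Finset.univ_prod_mulSingle fun i => (Multiplicative.ofAdd (1 : ZMod (q i))) ^ x i]
    funext i
    rw [← ofAdd_nsmul, nsmul_one]
  refine ⟨fun β => ⟨fun i => (Multiplicative.toAdd (β i)).val, ⟨fun i => ?_, ?_⟩, ?_⟩, hord⟩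
  · have : NeZero (q i) := ⟨(hq i).ne'⟩
    rw [hord]; exact ZMod.val_lt _
  · rw [hprod]
    funext i
    have : NeZero (q i) := ⟨(hq i).ne'⟩
    rw [ZMod.natCast_zmod_val, ofAdd_toAdd]
  · rintro y ⟨hy, rfl⟩
    funext i
    rw [hprod, toAdd_ofAdd, ZMod.val_natCast, Nat.mod_eq_of_lt (by simpa only [hord] using hy i)]

theorem exists_goodCode (a : ℕ × List ℕ) : ∃ n, GoodCode a n := by
  obtain ⟨p, e⟩ := a
  rcases Nat.lt_or_ge p 2 with hp | hp
  · exact ⟨0, .inl hp⟩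
  have hq : ∀ i : Fin e.length, 0 < p ^ e.get i := fun i => by positivity
  have : ∀ i : Fin e.length, NeZero (p ^ e.get i) := fun i => ⟨(hq i).ne'⟩
  have : ∀ i : Fin e.length, Finite (Multiplicative (ZMod (p ^ e.get i))) := fun i =>
    inferInstanceAs (Finite (ZMod (p ^ e.get i)))
  obtain ⟨h1, h2⟩ := isGroupBasis_mulSingle _ hq
  obtain ⟨τ, hτ⟩ := h1.exists_tableWorks h2 hp
  rw [List.ofFn_get] at hτ
  exact ⟨Encodable.encode τ, .inr (by simpa using hτ)⟩

open Classical in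
/-- The first table that works for the input. -/
noncomputable def searchTable (a : ℕ × List ℕ) : List (List ℕ × Move) :=
  (Encodable.decode (α := List (List ℕ × Move)) (Nat.find (exists_goodCode a))).getD []

theorem tableWorks_searchTable {a : ℕ × List ℕ} (ha : 2 ≤ a.1) : TableWorks a (searchTable a) := by
  classical
  exact (Nat.find_spec (exists_goodCode a)).resolve_left (by omega)

theorem computable_searchTable : Computable searchTable :=
  Computable.option_getD
    (Computable.decode.comp (computable_find primrecRel_goodCode exists_goodCode))
    (Computable.const [])

/-- The generic algorithm: find a table that works for the input, and follow it. -/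
noncomputable def tableAlgorithm : GenericAlgorithm (ℕ × List ℕ) (List ℕ) where
  next x := (tableMove (searchTable x.1) (pattern x.2)).toAction
  computable_next := primrec_toAction.to_comp.comp (primrec_tableMove.to_comp.comp
    (computable_searchTable.comp Computable.fst) (primrec_pattern.to_comp.comp Computable.snd))

theorem tableAlgorithm_computes {G : Type*} [CommGroup G] {k p : ℕ} {α : Fin k → G}
    {e : Fin k → ℕ} (hα : IsGroupBasis α) (he : ∀ i, orderOf (α i) = p ^ e i) (hp : 2 ≤ p)
    {ν : G → ℕ} (hν : Function.Injective ν) (β : G) :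
    ∃ (x : Fin k → ℕ) (t : ℕ), IsDiscreteLog α β x ∧
      tableAlgorithm.Computes (p, List.ofFn e) ν (List.ofFn α ++ [β]) t (List.ofFn x) ∧
      t ≤ inputBound (p, List.ofFn e) := by
  obtain ⟨x, hx, -⟩ := hα β
  have hmem : List.ofFn x ∈ allVectors (p, List.ofFn e) :=
    mem_allVectors_ofFn.2 ⟨x, fun i => he i ▸ hx.1 i, rfl⟩
  obtain ⟨t, ht, hc⟩ := computes_of_simulation hα he (by omega) (A := tableAlgorithm)
    (fun _ => rfl) hν _ _ (simStart_mem (by omega) hmem)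
    (tableWorks_searchTable (a := (p, List.ofFn e)) hp _ hmem)
  rw [map_simStart he, evalVec_ofFn, hx.2] at hc
  exact ⟨x, t, hx, hc, ht⟩

end Search

section Invariants

variable {G : Type*} [CommGroup G] {k : ℕ} {α : Fin k → G} {e : Fin k → ℕ} {p : ℕ}

theorem IsGroupBasis.card_eq_prod_orderOf (hα : IsGroupBasis α) :
    Nat.card G = ∏ i, orderOf (α i) := by
  have hbij : Function.Bijective
      fun x : (∀ i, Fin (orderOf (α i))) => ∏ i, α i ^ (x i : ℕ) := by
    refine ⟨fun x y h => ?_, fun β => ?_⟩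
    · have := (hα _).unique (y₁ := fun i => (x i : ℕ)) (y₂ := fun i => (y i : ℕ))
        ⟨fun i => (x i).2, h⟩ ⟨fun i => (y i).2, rfl⟩
      funext i
      exact Fin.ext (congrFun this i)
    · obtain ⟨x, ⟨hx, rfl⟩, -⟩ := hα β
      exact ⟨fun i => ⟨x i, hx i⟩, rfl⟩
  rw [← Nat.card_congr (Equiv.ofBijective _ hbij), Nat.card_pi]
  simp

theorem IsGroupBasis.pow_eq_one (hα : IsGroupBasis α) {N : ℕ} (h : ∀ i, orderOf (α i) ∣ N)
    (β : G) : β ^ N = 1 := by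
  obtain ⟨x, ⟨-, rfl⟩, -⟩ := hα β
  rw [← Finset.prod_pow]
  refine Finset.prod_eq_one fun i _ => ?_
  rw [← pow_mul, ← orderOf_dvd_iff_pow_eq_one]
  exact Dvd.dvd.mul_left (h i) _

/-- The socle has at least `p` to the number of nontrivial basis elements many elements. -/
theorem IsGroupBasis.pow_layerRank_le_card_ker [Finite G] (hα : IsGroupBasis α)
    (he : ∀ i, orderOf (α i) = p ^ e i) (hp : 2 ≤ p) :
    p ^ layerRank e 0 ≤ Nat.card (powMonoidHom p : G →* G).ker := by
  classical
  set I := Finset.univ.filter fun i => 0 < e i with hI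
  set x : (I → Fin p) → Fin k → ℕ := fun c i =>
    if h : i ∈ I then p ^ (e i - 1) * c ⟨i, h⟩ else 0 with hx
  have hpow : ∀ i ∈ I, p ^ (e i - 1) * p = p ^ e i := fun i hi => by
    have := (Finset.mem_filter.1 hi).2
    rw [← pow_succ, Nat.sub_add_cancel this]
  have hlt : ∀ c i, x c i < p ^ e i := fun c i => by
    simp only [hx]
    split_ifs with h
    · rw [← hpow i h]
      exact Nat.mul_lt_mul_of_pos_left (c ⟨i, h⟩).2 (by positivity)
    · positivity
  have hker : ∀ c, ∏ i, α i ^ x c i ∈ (powMonoidHom p : G →* G).ker := fun c => by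
    rw [MonoidHom.mem_ker, powMonoidHom_apply, ← Finset.prod_pow]
    refine Finset.prod_eq_one fun i _ => ?_
    rw [← pow_mul, ← orderOf_dvd_iff_pow_eq_one, he]
    simp only [hx]
    split_ifs with h
    · rw [mul_right_comm, hpow i h]
      exact dvd_mul_right _ _
    · simp
  have hinj : Function.Injective fun c => (⟨_, hker c⟩ : (powMonoidHom p : G →* G).ker) := by
    intro c d h
    have h1 := (hα _).unique (y₁ := x c) (y₂ := x d)
      ⟨fun i => he i ▸ hlt c i, Subtype.ext_iff.1 h⟩ ⟨fun i => he i ▸ hlt d i, rfl⟩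
    funext ⟨i, hi⟩
    have h2 := congrFun h1 i
    simp only [hx, dif_pos hi] at h2
    exact Fin.ext (Nat.eq_of_mul_eq_mul_left (by positivity) h2)
  have := Nat.card_le_card_of_injective _ hinj
  rwa [Nat.card_fun, Nat.card_eq_fintype_card, Nat.card_eq_fintype_card, Fintype.card_fin,
    Fintype.card_coe] at this

theorem IsGroupBasis.layerRank_le_rank [Finite G] (hα : IsGroupBasis α)
    (he : ∀ i, orderOf (α i) = p ^ e i) (hp : 2 ≤ p) : layerRank e 0 ≤ Group.rank G := by
  set H := (powMonoidHom p : G →* G).range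
  have h1 : Nat.card (G ⧸ H) ∣ p ^ Group.rank (G ⧸ H) := by
    refine card_dvd_exponent_pow_rank' _ fun g => ?_
    obtain ⟨g, rfl⟩ := QuotientGroup.mk_surjective g
    rw [← QuotientGroup.mk_pow, QuotientGroup.eq_one_iff]
    exact ⟨g, rfl⟩
  have h2 : Group.rank (G ⧸ H) ≤ Group.rank G :=
    Group.rank_le_of_surjective (QuotientGroup.mk' H) (QuotientGroup.mk'_surjective H)
  have h3 : Nat.card (G ⧸ H) = Nat.card (powMonoidHom p : G →* G).ker := by
    rw [← Subgroup.index_eq_card]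
    exact Subgroup.index_range
  have h4 : p ^ layerRank e 0 ≤ p ^ Group.rank G := by
    refine (hα.pow_layerRank_le_card_ker he hp).trans ?_
    rw [← h3]
    exact (Nat.le_of_dvd (by positivity) h1).trans (Nat.pow_le_pow_right (by omega) h2)
  exact (Nat.pow_le_pow_iff_right (by omega)).1 h4

end Invariants

section Bound

open Real

theorem depth_bound_le {m : ℕ} (hm : 1 ≤ m) :
    ((16 * (Nat.log 2 m + 1) / (Nat.log 2 (Nat.log 2 m + 1) + 2) : ℕ) : ℝ) ≤
      32 * (logb 2 ((m : ℝ) + 1) / logb 2 (logb 2 ((m : ℝ) + 2))) := by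
  set J := Nat.log 2 m + 1 with hJ
  have hm1 : (1 : ℝ) ≤ m := by exact_mod_cast hm
  have h1 : (1 : ℝ) ≤ logb 2 ((m : ℝ) + 1) := by
    rw [le_logb_iff_rpow_le (by norm_num) (by linarith), rpow_one]; linarith
  have h2 : (J : ℝ) ≤ 2 * logb 2 ((m : ℝ) + 1) := by
    have : (Nat.log 2 m : ℝ) ≤ logb 2 m := by simpa using natLog_le_logb m 2
    have h3 : logb 2 (m : ℝ) ≤ logb 2 ((m : ℝ) + 1) :=
      logb_le_logb_of_le (by norm_num) (by linarith) (by linarith)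
    rw [hJ]; push_cast; linarith
  have hlt : (m : ℝ) + 2 ≤ 2 ^ (J + 1) := by
    have h3 : m < 2 ^ J := Nat.lt_pow_succ_log_self (by norm_num) m
    have h4 : 2 ≤ 2 ^ J := Nat.le_self_pow (by omega) 2
    have : m + 2 ≤ 2 ^ (J + 1) := by rw [pow_succ]; omega
    exact_mod_cast this
  have h3 : logb 2 ((m : ℝ) + 2) ≤ J + 1 := by
    rw [logb_le_iff_le_rpow (by norm_num) (by linarith)]
    exact_mod_cast hlt
  have h4 : 1 < logb 2 ((m : ℝ) + 2) := by
    rw [lt_logb_iff_rpow_lt (by norm_num) (by linarith), rpow_one]; linarith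
  have h5 : 0 < logb 2 (logb 2 ((m : ℝ) + 2)) := logb_pos (by norm_num) h4
  have h6 : logb 2 (logb 2 ((m : ℝ) + 2)) ≤ Nat.log 2 J + 2 := by
    rw [logb_le_iff_le_rpow (by norm_num) (by linarith)]
    refine h3.trans ?_
    have h7 : J < 2 ^ (Nat.log 2 J + 1) := Nat.lt_pow_succ_log_self (by norm_num) J
    have h8 : J + 1 ≤ 2 ^ (Nat.log 2 J + 2) := by rw [pow_succ]; omega
    exact_mod_cast h8
  calc ((16 * J / (Nat.log 2 J + 2) : ℕ) : ℝ) ≤ ((16 * J : ℕ) : ℝ) / ((Nat.log 2 J + 2 : ℕ) : ℝ) :=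
        Nat.cast_div_le
    _ = 16 * (J / (Nat.log 2 J + 2)) := by push_cast; ring
    _ ≤ 16 * (2 * logb 2 ((m : ℝ) + 1) / logb 2 (logb 2 ((m : ℝ) + 2))) := by
        gcongr
    _ = _ := by ring

theorem costBound_le {p n m ρ r : ℕ} (hp : 2 ≤ p) (hm : 1 ≤ m) (hρ : 0 < ρ) (hr : ρ ≤ r) :
    (costBound p n m ρ : ℝ) ≤ 4608 * (logb 2 ((m : ℝ) + 1) / logb 2 (logb 2 ((m : ℝ) + 2)) *
      logb 2 ((p ^ n : ℕ) : ℝ) + (n : ℝ) / (r : ℝ) * (p : ℝ) ^ ((r : ℝ) / 2)) := by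
  have hp0 : (0 : ℝ) < p := by positivity
  have hρ0 : (0 : ℝ) < ρ := by exact_mod_cast hρ
  have hr0 : (0 : ℝ) < r := by exact_mod_cast hρ.trans_le hr
  have hL : (Nat.log 2 p : ℝ) ≤ logb 2 p := by simpa using natLog_le_logb p 2
  have hG : logb 2 ((p ^ n : ℕ) : ℝ) = n * logb 2 p := by
    rw [Nat.cast_pow, logb_pow]
  have hD := depth_bound_le hm
  have hsqrt : (Nat.sqrt (p ^ r) : ℝ) ≤ (p : ℝ) ^ ((r : ℝ) / 2) := by
    refine Real.nat_sqrt_le_real_sqrt.trans (le_of_eq ?_)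
    rw [Nat.cast_pow, Real.sqrt_eq_rpow, ← rpow_natCast, ← rpow_mul hp0.le]
    ring_nf
  have hmul : (r : ℝ) * Nat.sqrt (p ^ ρ) ≤ 3 * ρ * Nat.sqrt (p ^ r) := by
    exact_mod_cast mul_sqrt_pow_le hp hρ hr
  set D := 16 * (Nat.log 2 m + 1) / (Nat.log 2 (Nat.log 2 m + 1) + 2) with hDdef
  set R := logb 2 ((m : ℝ) + 1) / logb 2 (logb 2 ((m : ℝ) + 2))
  have h1 : (144 * Nat.log 2 p * D * n : ℝ) ≤ 4608 * (R * (n * logb 2 p)) := by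
    calc (144 * Nat.log 2 p * D * n : ℝ) ≤ 144 * logb 2 p * (32 * R) * n := by
          have : (0 : ℝ) ≤ logb 2 p := (Nat.cast_nonneg _).trans hL
          gcongr
      _ = _ := by ring
  have h2 : ((45 * n * Nat.sqrt (p ^ ρ) / ρ : ℕ) : ℝ) ≤
      135 * ((n : ℝ) / r * (p : ℝ) ^ ((r : ℝ) / 2)) := by
    calc ((45 * n * Nat.sqrt (p ^ ρ) / ρ : ℕ) : ℝ) ≤
          ((45 * n * Nat.sqrt (p ^ ρ) : ℕ) : ℝ) / (ρ : ℝ) := Nat.cast_div_le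
      _ = 45 * n * (r * Nat.sqrt (p ^ ρ)) / (ρ * r) := by push_cast; field_simp
      _ ≤ 45 * n * (3 * ρ * (p : ℝ) ^ ((r : ℝ) / 2)) / (ρ * r) := by
          have := hmul.trans (mul_le_mul_of_nonneg_left hsqrt (by positivity))
          gcongr
      _ = _ := by field_simp; ring
  have h3 : 0 ≤ (n : ℝ) / r * (p : ℝ) ^ ((r : ℝ) / 2) := by positivity
  unfold costBound
  rw [← hDdef, hG]
  push_cast at h1 h2 ⊢
  linarith

end Bound

theorem corollary1 :
    ∃ (A : GenericAlgorithm (ℕ × List ℕ) (List ℕ)) (C : ℝ),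
      ∀ (G : Type*) [CommGroup G] [Finite G] [Nontrivial G]
        (p n m r : ℕ), p.Prime → Nat.card G = p ^ n → Monoid.exponent G = p ^ m →
        Group.rank G = r →
      ∀ (k : ℕ) (α : Fin k → G) (e : Fin k → ℕ), IsGroupBasis α →
        (∀ i, orderOf (α i) = p ^ e i) →
      ∀ (ν : G → ℕ), Function.Injective ν →
      ∀ β : G, ∃ (x : Fin k → ℕ) (t : ℕ),
        IsDiscreteLog α β x ∧
        A.Computes (p, List.ofFn e) ν (List.ofFn α ++ [β]) t (List.ofFn x) ∧
        (t : ℝ) ≤ C *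
          (Real.logb 2 ((m : ℝ) + 1) / Real.logb 2 (Real.logb 2 ((m : ℝ) + 2)) *
              Real.logb 2 (Nat.card G : ℝ) +
            (n : ℝ) / (r : ℝ) * (p : ℝ) ^ ((r : ℝ) / 2)) := by
  refine ⟨tableAlgorithm, 4608, ?_⟩
  intro G _ _ _ p n m r hp hcard hexp hrank k α e hα he ν hν β
  have hp2 := hp.two_le
  obtain ⟨x, t, hx, hc, ht⟩ := tableAlgorithm_computes hα he hp2 hν β
  refine ⟨x, t, hx, hc, ?_⟩
  have hn : ∑ i, e i = n := by
    have h := hα.card_eq_prod_orderOf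
    simp only [he, Finset.prod_pow_eq_pow_sum] at h
    exact Nat.pow_right_injective hp2 (h.symm.trans hcard)
  have hem : ∀ i, e i ≤ m := fun i => by
    have h := Monoid.order_dvd_exponent (α i)
    rw [he, hexp] at h
    exact (Nat.pow_dvd_pow_iff_le_right hp.one_lt).1 h
  have hmax : (List.ofFn e).foldr max 0 = m := by
    refine le_antisymm (foldr_max_le fun b hb => ?_) ?_
    · obtain ⟨i, rfl⟩ := (List.mem_ofFn' e b).1 hb
      exact hem i
    · have h := Monoid.exponent_dvd_of_forall_pow_eq_one fun g =>
        hα.pow_eq_one (N := p ^ (List.ofFn e).foldr max 0) (fun i => by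
          rw [he]; exact pow_dvd_pow p (le_foldr_max (by simp))) g
      rw [hexp] at h
      exact (Nat.pow_dvd_pow_iff_le_right hp.one_lt).1 h
  have hm1 : 1 ≤ m := by
    by_contra hm0
    rw [show m = 0 by omega, pow_zero, Monoid.exp_eq_one_iff] at hexp
    exact not_subsingleton G hexp
  have hρ : 0 < layerRank e 0 := by
    rw [layerRank, Finset.card_pos]
    by_contra h
    rw [Finset.not_nonempty_iff_eq_empty, Finset.filter_eq_empty_iff] at h
    have h0 : m ≤ 0 := hmax ▸ foldr_max_le fun b hb => by
      obtain ⟨i, rfl⟩ := (List.mem_ofFn' e b).1 hb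
      have := h (Finset.mem_univ i)
      omega
    omega
  rw [inputBound_ofFn, hn, hmax] at ht
  rw [hcard]
  exact (Nat.cast_le.2 ht).trans
    (costBound_le hp2 hm1 hρ (hrank ▸ hα.layerRank_le_rank he hp2))
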